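/- **Setting.** Let $V=\{1,\dots,d\}$, $\mathcal E=[0,\infty)^d\setminus\{0\}$, $\mathcal L=\{x\in\mathcal E:\|x\|_\infty>1\}$ and $\mathcal L^\circ=\mathcal L\cap(0,\infty)^d$. Let $\Lambda$ be the exponent measure of a max-stable random vector $Z$ with standard Fréchet margins: $\Lambda$ is a measure on $\mathcal E$ such that, for all $z\in(0,\infty)^d$, $\Lambda(z):=\Lambda(\mathcal E\setminus[0,z])<\infty$ and $\mathbb P(Z\le z)=\exp\{-\Lambda(z)\}$. Let $Y$ be a random vector with the associated multivariate Pareto distribution: $Y\in\mathcal L$ almost surely and $\mathbb P(Y\le z)=\{\Lambda(z\wedge 1)-\Lambda(z)\}/\Lambda(1)$ for $z\in(0,\infty)^d$. Suppose that $Y$ has a Lebesgue density $f_Y$ on $\mathcal L$ which is positive and continuous on $\mathcal L^\circ$, and let $\lambda$ be the Lebesgue density of $\Lambda$, in its version that is continuous on $(0,\infty)^d$. For $I\subset V$ put $\lambda_I(y_I)=\int_{[0,\infty)^{d-|I|}}\lambda(y)\,dy_{V\setminus I}\in[0,\infty]$. A random vector $X$ in $\mathbb R^d$ with a Lebesgue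 density, whose marginal densities are written $f_I$ (with $f_\emptyset=1$), satisfies $X_A\perp X_C\mid X_B$, for disjoint $A,B,C\subset V$, if $f_{A\cup B\cup C}=f_{A\cup B}f_{B\cup C}/f_B$ almost everywhere. Write $Y_A\perp_e Y_C\mid Y_B$ if for every $k\in V$ the vector $Y^k$, that is $Y$ conditioned on $Y_k>1$, satisfies $Y^k_A\perp Y^k_C\mid Y^k_B$; here $B=\emptyset$ is allowed. Let $G=(V,E)$ be a decomposable graph, not assumed connected: a graph is decomposable if it is complete, or if $V$ is a disjoint union $A\cup B\cup C$ with $A,C\ne\emptyset$, $B$ complete, $B$ separating $A$ from $C$, and the subgraphs induced on $A\cup B$ and $B\cup C$ decomposable. Let $C_1,\dots,C_m$ be an enumeration, without repetition, of the cliques (maximal complete subsets) of $G$ with the running intersection property: for $i\ge2$, the separator $D_i=C_i\cap\bigcup_{j<i}C_j$ is contained in $C_k$ for some $k<i$. **Theorem.** The following are equivalent. 1. Pairwise Markov property: $Y_i\perp_e Y_j\mid Y_{V\setminus\{i,j\}}$ for all $i\neq j$ with $\{i,j\}\notin E$. 2. Global Markov property: $Y_A\perp_e Y_C\mid Y_B$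 for all disjoint $A,B,C\subset V$ with $A,C\neq\emptyset$ such that $B$ separates $A$ from $C$ in $G$. 3. Factorization: for almost every $y\in\mathcal L$, $$f_Y(y)=\frac1{\Lambda(1)}\,\frac{\prod_{i=1}^m\lambda_{C_i}(y_{C_i})}{\prod_{i=2}^m\lambda_{D_i}(y_{D_i})}.$$ 4. For every $y\in\mathcal L^\circ$, $\;\Lambda(1)\,f_Y(y)\prod_{i=2}^m\lambda_{D_i}(y_{D_i})=\prod_{i=1}^m\lambda_{C_i}(y_{C_i})$ as an identity in $[0,\infty]$; so the quotient formula of 3 holds at every $y\in\mathcal L^\circ$ at which all $\lambda_{D_i}(y_{D_i})$ are finite. If these conditions hold, then $G$ is connected. Moreover, for every non-empty $I\subset V$, the marginal $\lambda_I$ is positive on $(0,\infty)^I$, homogeneous of order $-(|I|+1)$, and finite almost everywhere. If $f_Y$ is bounded on $\mathcal L^\circ$ (in particular, if $f_Y$ is continuous on all of $\mathcal L$, including its boundary points with zero coordinates), then every such $\lambda_I$ is finite and continuous on $(0,\infty)^I$, so the formula in 3 holds at every $y\in\mathcal L^\circ$. -/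

import Mathlib

open MeasureTheory Set
open scoped ENNReal

namespace ExtremalGraph

/-! ### Graphs -/

/-- `B` separates `A` from `C` in the subgraph of `G` induced on `S`: every path inside `S` from
a vertex of `A` to a vertex of `C` meets `B`. -/
def SeparatesIn {V : Type*} (G : SimpleGraph V) (S A B C : Finset V) : Prop :=
  ∀ a ∈ A, ∀ c ∈ C, ∀ p : G.Walk a c, (∀ v ∈ p.support, v ∈ S) → ∃ v ∈ p.support, v ∈ B

/-- The subgraph of `G` induced on the vertex set `S` is decomposable: it is complete, or it has
a proper decomposition `(A, B, C)` into decomposable induced subgraphs on `A ∪ B` and `B ∪ C`. -/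
inductive DecomposableOn {V : Type*} [DecidableEq V] (G : SimpleGraph V) : Finset V → Prop
  | complete (S : Finset V) (hS : G.IsClique (S : Set V)) : DecomposableOn G S
  | decomposition (A B C : Finset V) (hAB : Disjoint A B) (hAC : Disjoint A C)
      (hBC : Disjoint B C) (hA : A.Nonempty) (hC : C.Nonempty)
      (hsep : SeparatesIn G (A ∪ B ∪ C) A B C) (hB : G.IsClique (B : Set V))
      (h₁ : DecomposableOn G (A ∪ B)) (h₂ : DecomposableOn G (B ∪ C)) :
      DecomposableOn G (A ∪ B ∪ C)

/-- A decomposable (finite, undirected) graph. -/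
def IsDecomposable {V : Type*} [Fintype V] [DecidableEq V] (G : SimpleGraph V) : Prop :=
  DecomposableOn G Finset.univ

/-- The set `D_i = C_i ∩ ⋃_{j < i} C_j` of a sequence `C` of vertex sets. -/
def separator {V : Type*} [DecidableEq V] {m : ℕ} (C : Fin m → Finset V) (i : Fin m) :
    Finset V :=
  C i ∩ (Finset.univ.filter (fun j => j < i)).biUnion C

/-- `C` lists every clique (maximal complete vertex set) of `G` exactly once, in an order with
the running intersection property. -/
structure IsCliqueSequence {V : Type*} [DecidableEq V] (G : SimpleGraph V) {m : ℕ}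
    (C : Fin m → Finset V) : Prop where
  injective : Function.Injective C
  clique_iff : ∀ s : Finset V,
    (∃ i, C i = s) ↔ Maximal (fun t : Finset V => G.IsClique (t : Set V)) s
  running_intersection : ∀ i : Fin m, 0 < i.val → ∃ k, k < i ∧ separator C i ⊆ C k

/-! ### The spaces -/

/-- The punctured orthant `[0,∞)^d \ {0}`. -/
def cone (d : ℕ) : Set (Fin d → ℝ) := {x | 0 ≤ x ∧ x ≠ 0}

/-- The open orthant `(0,∞)^d`. -/
def openOrthant (d : ℕ) : Set (Fin d → ℝ) := {x | ∀ i, 0 < x i}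

/-- The L-shaped space: points of the punctured orthant with maximum norm larger than one. -/
def lSpace (d : ℕ) : Set (Fin d → ℝ) := {x | x ∈ cone d ∧ 1 < ‖x‖}

/-! ### Max-stable laws, exponent measures, multivariate Pareto laws -/

/-- `μ` is the law of a max-stable random vector with standard Fréchet margins. -/
structure IsSimpleMaxStable {d : ℕ} (μ : Measure (Fin d → ℝ)) : Prop where
  isProbabilityMeasure : IsProbabilityMeasure μ
  frechet : ∀ j : Fin d, ∀ x : ℝ, 0 < x → μ.real {z | z j ≤ x} = Real.exp (-(1 / x))
  max_stable : ∀ n : ℕ, 0 < n → ∀ z : Fin d → ℝ,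
    μ.real (Iic ((n : ℝ) • z)) ^ n = μ.real (Iic z)

/-- `Λ(z)`, shorthand for the mass that `Λ` gives to the punctured orthant without `[0, z]`. -/
noncomputable def expo {d : ℕ} (Λ : Measure (Fin d → ℝ)) (z : Fin d → ℝ) : ℝ≥0∞ :=
  Λ (cone d \ Icc 0 z)

/-- `Λ` is the exponent measure of a max-stable vector `Z` with standard Fréchet margins:
it lives on the punctured orthant, is finite away from the origin, and
`P(Z ≤ z) = exp(-Λ(z))`. -/
structure IsExponentMeasure {d : ℕ} (Λ : Measure (Fin d → ℝ)) : Prop where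
  compl_cone : Λ (cone d)ᶜ = 0
  finite : ∀ z ∈ openOrthant d, expo Λ z ≠ ∞
  exists_maxStable : ∃ μ : Measure (Fin d → ℝ), IsSimpleMaxStable μ ∧
    ∀ z ∈ openOrthant d, μ.real (Iic z) = Real.exp (-(expo Λ z).toReal)

/-- `P` is the multivariate Pareto law with exponent measure `Λ`: it lives on the L-shaped space
and `P(Y ≤ z) = (Λ(z ∧ 1) - Λ(z)) / Λ(1)`. -/
structure IsMultivariatePareto {d : ℕ} (P Λ : Measure (Fin d → ℝ)) : Prop where
  isProbabilityMeasure : IsProbabilityMeasure P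
  isExponentMeasure : IsExponentMeasure Λ
  compl_lSpace : P (lSpace d)ᶜ = 0
  cdf : ∀ z ∈ openOrthant d,
    P.real (Iic z) = ((expo Λ (z ⊓ 1)).toReal - (expo Λ z).toReal) / (expo Λ 1).toReal

/-- The marginal `lam_I(y_I) = ∫_{[0,∞)^{d-|I|}} lam(y) dy_{V \ I}` of an exponent measure density,
as a `[0,∞]`-valued function of `y` that only depends on the coordinates `y_i` with `i ∈ I`. -/
noncomputable def expMarginal {d : ℕ} (lam : (Fin d → ℝ) → ℝ) (I : Finset (Fin d)) :
    (Fin d → ℝ) → ℝ≥0∞ :=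
  lmarginal (fun _ : Fin d => (volume : Measure ℝ).restrict (Ici 0)) Iᶜ
    (fun y => ENNReal.ofReal (lam y))

/-! ### Conditional independence -/

/-- The Lebesgue density of the `I`-marginal of an absolutely continuous law `μ` on `ℝ^d`, as
a function of `x` that only depends on the coordinates `x_i` with `i ∈ I`. -/
noncomputable def margDensity {d : ℕ} (μ : Measure (Fin d → ℝ)) (I : Finset (Fin d)) :
    (Fin d → ℝ) → ℝ≥0∞ :=
  lmarginal (fun _ : Fin d => (volume : Measure ℝ)) Iᶜ (μ.rnDeriv volume)

/-- For a random vector `X` with absolutely continuous law `μ`: `X_A` and `X_C` are conditionally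
independent given `X_B`, that is, `f_{A∪B∪C} = f_{A∪B} f_{B∪C} / f_B`.
For `B = ∅` this is independence of `X_A` and `X_C`. -/
def CondIndepGiven {d : ℕ} (μ : Measure (Fin d → ℝ)) (A B C : Finset (Fin d)) : Prop :=
  ∀ᵐ x ∂(volume : Measure (Fin d → ℝ)),
    margDensity μ (A ∪ B ∪ C) x
      = margDensity μ (A ∪ B) x * margDensity μ (B ∪ C) x / margDensity μ B x

/-- Extremal conditional independence of `Y_A` and `Y_C` given `Y_B`, where `P` is the law of `Y`:
for every `k`, the vector `Y` conditioned on `Y_k > 1` has the corresponding classical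
conditional independence. -/
def ExtCondIndep {d : ℕ} (P : Measure (Fin d → ℝ)) (A B C : Finset (Fin d)) : Prop :=
  ∀ k : Fin d, CondIndepGiven (ProbabilityTheory.cond P {y | 1 < y k}) A B C

/-- The pairwise Markov property for extremal conditional independence. -/
def PairwiseMarkov {d : ℕ} (G : SimpleGraph (Fin d)) (P : Measure (Fin d → ℝ)) : Prop :=
  ∀ i j : Fin d, i ≠ j → ¬ G.Adj i j → ExtCondIndep P {i} {i, j}ᶜ {j}

/-- The global Markov property for extremal conditional independence. -/
def GlobalMarkov {d : ℕ} (G : SimpleGraph (Fin d)) (P : Measure (Fin d → ℝ)) : Prop :=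
  ∀ A B C : Finset (Fin d), A.Nonempty → C.Nonempty →
    Disjoint A B → Disjoint A C → Disjoint B C →
    SeparatesIn G Finset.univ A B C → ExtCondIndep P A B C

end ExtremalGraph

/-! Everything reduces to one property of `lam`: for non-adjacent `i` and `j` the mixed second
difference of `log lam` in these two coordinates vanishes, written multiplicatively as
`NoInteraction lam {i} {j}`. The Pareto law is `Λ` restricted to the L-shaped space and normalized,
so up to null sets `Y` given `Y_k > 1` has a constant multiple of `lam` on a product set as its
density. Max-stability makes `lam` homogeneous, hence positive on the whole open orthant.

Pairwise conditional independence, or the almost everywhere factorization, writes `lam` on some set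
`{y_k > 1}` as a product and quotient of functions none of which depends on both `i` and `j`. The
four-point identity follows almost everywhere, then everywhere by continuity, and homogeneity
carries it to the open orthant (`IsExponentDensity.noInteraction_of_ae`).

Conversely, positivity joins pairs into sets: if no edge joins `A'` to `C'`, then `lam` has no
interaction between them. Integrating the four-point identity gives `h_{ABC} h_B = h_{AB} h_{BC}` in
`[0,∞]` with no finiteness assumption (`FourPoint.integrateOut_mul_integrateOut`). For `lam` cut
down to `{y_k > 1}` this is the global Markov property; for `lam` itself it telescopes along the
clique sequence to the everywhere factorization.

Division needs finite separator marginals. For non-empty `I` the marginal is finite almost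
everywhere, because `Λ` has finite mass away from the origin. For empty `I` homogeneity makes it
infinite; this excludes empty separators and forces `G` to be connected. -/

namespace ExtremalGraph

/-! ### Partial integration on `ℝ^d` -/

section Marginals

variable {d : ℕ}

/-- The integral of `h` over the coordinates in `s`. -/
noncomputable def integrateOut (s : Finset (Fin d)) (h : (Fin d → ℝ) → ℝ≥0∞) :
    (Fin d → ℝ) → ℝ≥0∞ :=
  lmarginal (fun _ : Fin d => (volume : Measure ℝ)) s h

theorem integrateOut_apply (s : Finset (Fin d)) (h : (Fin d → ℝ) → ℝ≥0∞) (y : Fin d → ℝ) :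
    integrateOut s h y = ∫⁻ x : s → ℝ, h (Function.updateFinset y s x) := rfl

theorem _root_.Measurable.comp_updateFinset {s : Finset (Fin d)} {h : (Fin d → ℝ) → ℝ≥0∞}
    (hh : Measurable h) (y : Fin d → ℝ) :
    Measurable fun x : s → ℝ => h (Function.updateFinset y s x) :=
  hh.comp measurable_updateFinset

theorem measurable_integrateOut {s : Finset (Fin d)} {h : (Fin d → ℝ) → ℝ≥0∞}
    (hh : Measurable h) : Measurable (integrateOut s h) :=
  Measurable.lmarginal _ hh

theorem integrateOut_congr {s : Finset (Fin d)} (h : (Fin d → ℝ) → ℝ≥0∞) {x y : Fin d → ℝ}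
    (hxy : ∀ i ∉ s, x i = y i) : integrateOut s h x = integrateOut s h y :=
  lmarginal_congr _ h hxy

theorem integrateOut_empty (h : (Fin d → ℝ) → ℝ≥0∞) : integrateOut ∅ h = h :=
  lmarginal_empty _ h

theorem integrateOut_univ (h : (Fin d → ℝ) → ℝ≥0∞) (y : Fin d → ℝ) :
    integrateOut Finset.univ h y = ∫⁻ x, h x :=
  congrFun (lmarginal_univ (μ := fun _ : Fin d => (volume : Measure ℝ)) (f := h)) y

theorem integrateOut_union {s t : Finset (Fin d)} {h : (Fin d → ℝ) → ℝ≥0∞} (hh : Measurable h)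
    (hst : Disjoint s t) : integrateOut (s ∪ t) h = integrateOut s (integrateOut t h) :=
  lmarginal_union _ h hh hst

theorem lintegral_eq_integrateOut_compl (s : Finset (Fin d)) {h : (Fin d → ℝ) → ℝ≥0∞}
    (hh : Measurable h) (y : Fin d → ℝ) :
    ∫⁻ x, h x = integrateOut sᶜ (integrateOut s h) y := by
  rw [← integrateOut_univ h y, ← integrateOut_union hh disjoint_compl_left,
    Finset.union_comm, Finset.union_compl]

theorem integrateOut_mul_right {s : Finset (Fin d)} {u v : (Fin d → ℝ) → ℝ≥0∞}
    (hu : Measurable u) (hv : ∀ x y : Fin d → ℝ, (∀ i ∉ s, x i = y i) → v x = v y)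
    (y : Fin d → ℝ) :
    integrateOut s (fun x => u x * v x) y = integrateOut s u y * v y := by
  rw [integrateOut_apply, integrateOut_apply,
    ← lintegral_mul_const _ (hu.comp_updateFinset y)]
  refine lintegral_congr fun x => ?_
  rw [hv (Function.updateFinset y s x) y (fun i hi => by simp [Function.updateFinset, hi])]

theorem integrateOut_mul_left {s : Finset (Fin d)} {u v : (Fin d → ℝ) → ℝ≥0∞}
    (hv : Measurable v) (hu : ∀ x y : Fin d → ℝ, (∀ i ∉ s, x i = y i) → u x = u y)
    (y : Fin d → ℝ) :
    integrateOut s (fun x => u x * v x) y = u y * integrateOut s v y := by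
  simp_rw [mul_comm (u _)]
  exact integrateOut_mul_right hv hu y

theorem volume_eq_zero_of_forall_ae_updateFinset (s : Finset (Fin d)) {N : Set (Fin d → ℝ)}
    (hN : MeasurableSet N)
    (h : ∀ y, ∀ᵐ x : s → ℝ, Function.updateFinset y s x ∉ N) : volume N = 0 := by
  have h1 : integrateOut s (N.indicator 1) = 0 := by
    ext y
    rw [integrateOut_apply, Pi.zero_apply, lintegral_eq_zero_iff
      ((measurable_one.indicator hN).comp_updateFinset y)]
    filter_upwards [h y] with x hx
    simp [hx]
  rw [← lintegral_indicator_one hN,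
    lintegral_eq_integrateOut_compl s (measurable_one.indicator hN) 0, h1]
  simp [integrateOut_apply]

/-- By Tonelli, almost every section of a null set is null. This is needed because marginal
densities are built from a Radon-Nikodym derivative, which is known only almost everywhere. -/
theorem integrateOut_ae_congr (s : Finset (Fin d)) {g h : (Fin d → ℝ) → ℝ≥0∞}
    (hgh : g =ᵐ[volume] h) : integrateOut s g =ᵐ[volume] integrateOut s h := by
  set N := toMeasurable volume {y | g y ≠ h y} with hN
  have hNm : MeasurableSet N := measurableSet_toMeasurable _ _
  have hN0 : volume N = 0 := by rw [hN, measure_toMeasurable]; exact hgh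
  have hind : Measurable (N.indicator (1 : (Fin d → ℝ) → ℝ≥0∞)) := measurable_one.indicator hNm
  set K := {y | integrateOut s (N.indicator 1) y ≠ 0} with hK
  have hKm : MeasurableSet K :=
    (measurable_integrateOut hind) (measurableSet_singleton 0).compl
  have hK0 : volume K = 0 := by
    refine volume_eq_zero_of_forall_ae_updateFinset sᶜ hKm fun y => ?_
    have := lintegral_eq_integrateOut_compl s hind y
    rw [lintegral_indicator_one hNm, hN0, integrateOut_apply] at this
    have := (lintegral_eq_zero_iff
      ((measurable_integrateOut hind).comp_updateFinset y)).1 this.symm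
    filter_upwards [this] with x hx
    simpa [hK] using hx
  have : ∀ᵐ y, y ∉ K := measure_eq_zero_iff_ae_notMem.1 hK0
  filter_upwards [this] with y hy
  simp only [hK, mem_ofPred_eq, not_not] at hy
  rw [integrateOut_apply, lintegral_eq_zero_iff (hind.comp_updateFinset y)] at hy
  rw [integrateOut_apply, integrateOut_apply]
  refine lintegral_congr_ae ?_
  filter_upwards [hy] with x hx
  by_contra hne
  have : Function.updateFinset y s x ∈ N := subset_toMeasurable _ _ hne
  simp [this] at hx

theorem integrateOut_ne_top_ae {s : Finset (Fin d)} {h : (Fin d → ℝ) → ℝ≥0∞} (hh : Measurable h)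
    (hfin : ∫⁻ x, h x ≠ ∞) : ∀ᵐ y, integrateOut s h y ≠ ∞ := by
  refine measure_eq_zero_iff_ae_notMem.1 (volume_eq_zero_of_forall_ae_updateFinset sᶜ
    ((measurable_integrateOut hh) (measurableSet_singleton ∞)) fun y => ?_)
  rw [lintegral_eq_integrateOut_compl s hh y, integrateOut_apply] at hfin
  filter_upwards [ae_lt_top ((measurable_integrateOut hh).comp_updateFinset y) hfin]
    with x hx
  exact hx.ne

theorem integrateOut_pos {s : Finset (Fin d)} {h : (Fin d → ℝ) → ℝ≥0∞} (hh : Measurable h)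
    (T : Fin d → Set ℝ) (hT : ∀ i, volume (T i) ≠ 0) (hpos : ∀ y, (∀ i, y i ∈ T i) → 0 < h y)
    {y : Fin d → ℝ} (hy : ∀ i ∉ s, y i ∈ T i) : 0 < integrateOut s h y := by
  rw [integrateOut_apply, lintegral_pos_iff_support (hh.comp_updateFinset y)]
  have h1 : (univ : Set s).pi (fun i => T i) ⊆
      Function.support (fun x : s → ℝ => h (Function.updateFinset y s x)) := by
    intro x hx
    refine (hpos _ fun i => ?_).ne'
    by_cases hi : i ∈ s
    · simpa [Function.updateFinset, hi] using hx ⟨i, hi⟩ (mem_univ _)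
    · simpa [Function.updateFinset, hi] using hy i hi
  refine lt_of_lt_of_le ?_ (measure_mono h1)
  rw [volume_pi_pi, pos_iff_ne_zero, Finset.prod_ne_zero_iff]
  exact fun i _ => hT i

end Marginals

/-! ### The four-point identity -/

section FourPoint

variable {d : ℕ}

/-- `h` has no interaction between the coordinates in `A` and those in `C`, multiplicatively. -/
def FourPoint (h : (Fin d → ℝ) → ℝ≥0∞) (A C : Finset (Fin d)) : Prop :=
  ∀ y z : Fin d → ℝ, h y * h ((A ∪ C).piecewise z y) = h (A.piecewise z y) * h (C.piecewise z y)

/-- Integrate the four-point identity over the `A` and `C` coordinates of `z` with `y` fixed; the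
right side is a function of `z_A` times a function of `z_C`, so the integral splits, even when
values are infinite. -/
theorem FourPoint.mul_integrateOut {h : (Fin d → ℝ) → ℝ≥0∞} (hh : Measurable h)
    {A C : Finset (Fin d)} (hAC : Disjoint A C) (hfp : FourPoint h A C) (y : Fin d → ℝ) :
    h y * integrateOut (A ∪ C) h y = integrateOut C h y * integrateOut A h y := by
  have key : ∀ (a : A → ℝ) (c : C → ℝ),
      h y * h (Function.updateFinset (Function.updateFinset y A a) C c) =
        h (Function.updateFinset y A a) * h (Function.updateFinset y C c) := by
    intro a c
    have := hfp y (Function.updateFinset (Function.updateFinset y A a) C c)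
    convert this using 3
    · ext i
      by_cases hA : i ∈ A <;> by_cases hC : i ∈ C <;>
        simp [Function.updateFinset, Finset.piecewise, hA, hC]
    · ext i
      by_cases hA : i ∈ A <;> by_cases hC : i ∈ C <;>
        simp [Function.updateFinset, Finset.piecewise, hA, hC]
      exact absurd hC (Finset.disjoint_left.1 hAC hA)
    · ext i
      by_cases hA : i ∈ A <;> by_cases hC : i ∈ C <;>
        simp [Function.updateFinset, Finset.piecewise, hC]
  rw [integrateOut_union hh hAC, integrateOut_apply, ← lintegral_const_mul _
    ((measurable_integrateOut hh).comp_updateFinset y)]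
  rw [integrateOut_apply A h, mul_comm (integrateOut C h y), ← lintegral_mul_const _
    (hh.comp_updateFinset y)]
  refine lintegral_congr fun a => ?_
  rw [integrateOut_apply, integrateOut_apply, ← lintegral_const_mul _
    (hh.comp_updateFinset _), ← lintegral_const_mul _ (hh.comp_updateFinset _)]
  exact lintegral_congr fun c => key a c

/-- Marginals of a function without interaction between `A'` and `C'` factorize. -/
theorem FourPoint.integrateOut_mul_integrateOut {h : (Fin d → ℝ) → ℝ≥0∞} (hh : Measurable h)
    {A A' B C C' : Finset (Fin d)} (hA : A ⊆ A') (hC : C ⊆ C')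
    (hAC : Disjoint A' C') (hAB : Disjoint A' B) (hBC : Disjoint B C')
    (hU : A' ∪ B ∪ C' = Finset.univ) (hfp : FourPoint h A' C') (y : Fin d → ℝ) :
    integrateOut (A ∪ B ∪ C)ᶜ h y * integrateOut Bᶜ h y =
      integrateOut (A ∪ B)ᶜ h y * integrateOut (B ∪ C)ᶜ h y := by
  have hmem : ∀ i, i ∈ A' ∨ i ∈ B ∨ i ∈ C' := fun i => by
    have := Finset.mem_univ i
    rw [← hU] at this
    simpa [or_assoc] using this
  have hAC' : ∀ i, i ∈ A' → i ∉ C' := fun i hi => Finset.disjoint_left.1 hAC hi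
  have hAB' : ∀ i, i ∈ A' → i ∉ B := fun i hi => Finset.disjoint_left.1 hAB hi
  have hBC' : ∀ i, i ∈ B → i ∉ C' := fun i hi => Finset.disjoint_left.1 hBC hi
  have hA' : ∀ i, i ∈ A → i ∈ A' := fun i hi => hA hi
  have hC' : ∀ i, i ∈ C → i ∈ C' := fun i hi => hC hi
  have e1 : Bᶜ = A' ∪ C' := by
    ext i
    have := hmem i; have := hAB' i; have := hBC' i
    simp only [Finset.mem_compl, Finset.mem_union]
    tauto
  have e2 : (A ∪ B ∪ C)ᶜ = (C' \ C) ∪ (A' \ A) := by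
    ext i
    have := hmem i; have := hAB' i; have := hBC' i; have := hAC' i; have := hA' i; have := hC' i
    simp only [Finset.mem_compl, Finset.mem_union, Finset.mem_sdiff]
    tauto
  have e3 : (A ∪ B)ᶜ = (A' \ A) ∪ C' := by
    ext i
    have := hmem i; have := hAB' i; have := hBC' i; have := hAC' i; have := hA' i
    simp only [Finset.mem_compl, Finset.mem_union, Finset.mem_sdiff]
    tauto
  have e4 : (B ∪ C)ᶜ = (C' \ C) ∪ A' := by
    ext i
    have := hmem i; have := hAB' i; have := hBC' i; have := hAC' i; have := hC' i
    simp only [Finset.mem_compl, Finset.mem_union, Finset.mem_sdiff]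
    tauto
  have d1 : Disjoint (C' \ C) (A' \ A) :=
    hAC.symm.mono Finset.sdiff_subset Finset.sdiff_subset
  have d2 : Disjoint (A' \ A) C' := hAC.mono_left Finset.sdiff_subset
  have d3 : Disjoint (C' \ C) A' := hAC.symm.mono_left Finset.sdiff_subset
  have m1 := measurable_integrateOut (s := C') hh
  have m2 := measurable_integrateOut (s := A') hh
  -- Integrating this identity over the coordinates outside `A ∪ B ∪ C` gives the claim: the
  -- marginal on `B` is constant in them, and on the right each factor depends on only one of the
  -- two blocks `A' \ A` and `C' \ C`.
  have hcov : (fun x => h x * integrateOut Bᶜ h x) =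
      fun x => integrateOut C' h x * integrateOut A' h x := by
    ext x
    rw [e1]
    exact hfp.mul_integrateOut hh hAC x
  have hleft : integrateOut (A ∪ B ∪ C)ᶜ (fun x => h x * integrateOut Bᶜ h x) y =
      integrateOut (A ∪ B ∪ C)ᶜ h y * integrateOut Bᶜ h y := by
    refine integrateOut_mul_right hh (fun x z hxz => integrateOut_congr h fun i hi => hxz i ?_) y
    simp only [Finset.mem_compl, Finset.mem_union, not_not] at hi ⊢
    tauto
  rw [← hleft, hcov, e2, integrateOut_union
    (h := fun x => integrateOut C' h x * integrateOut A' h x) (m1.mul m2) d1]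
  have hinner : integrateOut (A' \ A) (fun x => integrateOut C' h x * integrateOut A' h x) =
      fun x => integrateOut ((A' \ A) ∪ C') h x * integrateOut A' h x := by
    ext x
    rw [integrateOut_union hh d2]
    refine integrateOut_mul_right m1 (fun x z hxz => integrateOut_congr h fun i hi => hxz i ?_) x
    exact fun hi' => hi (Finset.sdiff_subset hi')
  rw [hinner, e3, e4, integrateOut_union (s := C' \ C) hh d3]
  refine integrateOut_mul_left m2 (fun x z hxz => integrateOut_congr h fun i hi => hxz i ?_) y
  simp only [Finset.mem_union, Finset.mem_sdiff, not_or] at hi ⊢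
  tauto

/-- Exchanging the coordinates in `s` between the two points of a pair. -/
theorem measurePreserving_exchange (s : Finset (Fin d)) :
    MeasurePreserving (fun p : (Fin d → ℝ) × (Fin d → ℝ) =>
      (s.piecewise p.2 p.1, s.piecewise p.1 p.2)) := by
  have h1 := measurePreserving_arrowProdEquivProdArrow ℝ ℝ (Fin d)
    (fun _ => (volume : Measure ℝ)) (fun _ => volume)
  have h2 : MeasurePreserving (fun (q : Fin d → ℝ × ℝ) i => if i ∈ s then (q i).swap else q i)
      (Measure.pi fun _ => (volume : Measure ℝ).prod volume)
      (Measure.pi fun _ => (volume : Measure ℝ).prod volume) := by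
    refine measurePreserving_pi (f := fun i (x : ℝ × ℝ) => if i ∈ s then x.swap else x) _ _
      fun i => ?_
    by_cases hi : i ∈ s
    · simp only [hi, if_true]
      exact Measure.measurePreserving_swap
    · simp only [hi, if_false]
      exact MeasurePreserving.id _
  refine (show (fun p : (Fin d → ℝ) × (Fin d → ℝ) => (s.piecewise p.2 p.1, s.piecewise p.1 p.2)) =
      _ from ?_) ▸ (h1.comp h2).comp h1.symm
  ext p i <;> by_cases hi : i ∈ s <;>
    simp [hi, MeasurableEquiv.arrowProdEquivProdArrow, Equiv.arrowProdEquivProdArrow]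

/-- Mixing is the exchange followed by a projection. Hence an identity valid at almost every point
also holds at the mixtures of almost every pair. -/
theorem quasiMeasurePreserving_piecewise (s : Finset (Fin d)) :
    Measure.QuasiMeasurePreserving (fun p : (Fin d → ℝ) × (Fin d → ℝ) => s.piecewise p.2 p.1)
      volume volume :=
  Measure.quasiMeasurePreserving_fst.comp (measurePreserving_exchange s).quasiMeasurePreserving

end FourPoint

/-! ### Separations of graphs and clique sequences -/

section Graphs

variable {V : Type*}

/-- `(A, B, C)` partitions the vertex set, and no edge joins `A` to `C`. -/
structure IsSeparation [Fintype V] [DecidableEq V] (G : SimpleGraph V) (A B C : Finset V) :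
    Prop where
  disjoint_left : Disjoint A B
  disjoint_outer : Disjoint A C
  disjoint_right : Disjoint B C
  cover : A ∪ B ∪ C = Finset.univ
  not_adj : ∀ a ∈ A, ∀ c ∈ C, ¬ G.Adj a c

/-- `A'` collects the vertices reached from `A` by walks avoiding `B`, and `C'` is the rest. The
four-point argument needs such a partition of all coordinates. -/
theorem SeparatesIn.exists_isSeparation [Fintype V] [DecidableEq V] {G : SimpleGraph V}
    {A B C : Finset V} (hAB : Disjoint A B) (hBC : Disjoint B C)
    (h : SeparatesIn G Finset.univ A B C) :
    ∃ A' C', A ⊆ A' ∧ C ⊆ C' ∧ IsSeparation G A' B C' := by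
  classical
  set A' := Finset.univ.filter fun v => ∃ a ∈ A, ∃ p : G.Walk a v, ∀ w ∈ p.support, w ∉ B with hA'
  have hA'B : Disjoint A' B := by
    rw [Finset.disjoint_left]
    intro v hv
    obtain ⟨a, -, p, hp⟩ := (Finset.mem_filter.1 hv).2
    exact hp v p.end_mem_support
  refine ⟨A', (A' ∪ B)ᶜ, ?_, ?_, hA'B, ?_, ?_, ?_, ?_⟩
  · intro a ha
    refine Finset.mem_filter.2 ⟨Finset.mem_univ _, a, ha, .nil, ?_⟩
    simpa using Finset.disjoint_left.1 hAB ha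
  · intro c hc
    simp only [Finset.mem_compl, Finset.mem_union, not_or]
    refine ⟨fun hcA => ?_, Finset.disjoint_right.1 hBC hc⟩
    obtain ⟨a, ha, p, hp⟩ := (Finset.mem_filter.1 hcA).2
    obtain ⟨v, hv, hvB⟩ := h a ha c hc p (fun _ _ => Finset.mem_univ _)
    exact hp v hv hvB
  · rw [Finset.disjoint_left]
    intro a ha hc
    simp [ha] at hc
  · rw [Finset.disjoint_left]
    intro a ha hc
    simp [ha] at hc
  · exact Finset.union_compl _
  · intro v hv c hc hadj
    simp only [Finset.mem_compl, Finset.mem_union, not_or] at hc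
    obtain ⟨a, ha, p, hp⟩ := (Finset.mem_filter.1 hv).2
    refine hc.1 (Finset.mem_filter.2 ⟨Finset.mem_univ _, a, ha, p.concat hadj, fun w hw => ?_⟩)
    rw [SimpleGraph.Walk.support_concat] at hw
    simp only [List.mem_append, List.mem_singleton] at hw
    rcases hw with hw | rfl
    · exact hp w hw
    · exact hc.2

theorem separatesIn_pair [Fintype V] [DecidableEq V] {G : SimpleGraph V} {i j : V} (hij : i ≠ j)
    (hadj : ¬ G.Adj i j) : SeparatesIn G Finset.univ {i} {i, j}ᶜ {j} := by
  intro a ha c hc p _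
  rw [Finset.mem_singleton] at ha hc
  subst ha hc
  cases p with
  | nil => exact absurd rfl hij
  | @cons _ v _ hav q =>
    refine ⟨v, by simp, ?_⟩
    simp only [Finset.mem_compl, Finset.mem_insert, Finset.mem_singleton, not_or]
    refine ⟨hav.ne', ?_⟩
    rintro rfl
    exact hadj hav

/-- The union of the first `n` members of a sequence of vertex sets. -/
def initialUnion [DecidableEq V] {m : ℕ} (C : Fin m → Finset V) (n : ℕ) : Finset V :=
  (Finset.univ.filter (fun j : Fin m => j.val < n)).biUnion C

variable [DecidableEq V] {m : ℕ} {C : Fin m → Finset V}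

theorem mem_initialUnion {n : ℕ} {v : V} :
    v ∈ initialUnion C n ↔ ∃ j : Fin m, j.val < n ∧ v ∈ C j := by
  simp [initialUnion]

theorem mem_separator {i : Fin m} {v : V} :
    v ∈ separator C i ↔ v ∈ C i ∧ v ∈ initialUnion C i.val := by
  simp [separator, mem_initialUnion]

theorem initialUnion_succ (i : Fin m) :
    initialUnion C (i.val + 1) = initialUnion C i.val ∪ C i := by
  ext v
  simp only [mem_initialUnion, Finset.mem_union]
  constructor
  · rintro ⟨j, hj, hv⟩
    rcases Nat.lt_succ_iff_lt_or_eq.1 hj with h | h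
    · exact .inl ⟨j, h, hv⟩
    · exact .inr (Fin.ext h ▸ hv)
  · rintro (⟨j, hj, hv⟩ | hv)
    · exact ⟨j, by omega, hv⟩
    · exact ⟨i, by omega, hv⟩

variable {G : SimpleGraph V}

theorem IsCliqueSequence.exists_subset [Fintype V] (hC : IsCliqueSequence G C) {s : Finset V}
    (hs : G.IsClique (s : Set V)) : ∃ i, s ⊆ C i := by
  obtain ⟨t, hst, ht⟩ := (Set.toFinite {t : Finset V | G.IsClique (t : Set V)}).exists_le_maximal
    (a := s) hs
  obtain ⟨i, rfl⟩ := (hC.clique_iff t).2 ht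
  exact ⟨i, hst⟩

theorem IsCliqueSequence.initialUnion_eq_univ [Fintype V] (hC : IsCliqueSequence G C) :
    initialUnion C m = Finset.univ := by
  ext v
  obtain ⟨i, hi⟩ := hC.exists_subset (s := {v}) (by simp)
  simp only [mem_initialUnion, Finset.mem_univ, iff_true]
  exact ⟨i, i.2, hi (by simp)⟩

/-- The separator `D_i` separates `C_i` from the earlier cliques, and every clique up to the
`n`-th one lies on one side. -/
theorem IsCliqueSequence.exists_sides (hC : IsCliqueSequence G C) (i : Fin m) {n : ℕ}
    (hin : i.val + 1 ≤ n) (hnm : n ≤ m) :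
    ∃ A' C' : Finset V, initialUnion C i.val \ separator C i ⊆ A' ∧
      C i \ separator C i ⊆ C' ∧ Disjoint A' C' ∧ Disjoint A' (separator C i) ∧
      Disjoint C' (separator C i) ∧ A' ⊆ initialUnion C n ∧ C' ⊆ initialUnion C n ∧
      ∀ j : Fin m, j.val < n → C j ⊆ A' ∪ separator C i ∨ C j ⊆ C' ∪ separator C i := by
  set D := separator C i with hD
  induction n, hin using Nat.le_induction with
  | base =>
    refine ⟨initialUnion C i.val \ D, C i \ D, subset_rfl, subset_rfl, ?_,
      Finset.sdiff_disjoint, Finset.sdiff_disjoint, ?_, ?_, ?_⟩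
    · rw [Finset.disjoint_left]
      intro v hv hv'
      rw [Finset.mem_sdiff] at hv hv'
      exact hv.2 (mem_separator.2 ⟨hv'.1, hv.1⟩)
    · rw [initialUnion_succ]
      exact Finset.sdiff_subset.trans Finset.subset_union_left
    · rw [initialUnion_succ]
      exact Finset.sdiff_subset.trans Finset.subset_union_right
    · intro j hj
      rcases Nat.lt_succ_iff_lt_or_eq.1 hj with h | h
      · refine .inl fun v hv => ?_
        have : v ∈ initialUnion C i.val := mem_initialUnion.2 ⟨j, h, hv⟩
        by_cases hvD : v ∈ D <;> simp [this, hvD]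
      · obtain rfl := Fin.ext h
        refine .inr fun v hv => ?_
        by_cases hvD : v ∈ D <;> simp [hv, hvD]
  | succ n hin ih =>
    obtain ⟨A', C', hA, hC', hAC, hAD, hCD, hAU, hCU, hcov⟩ := ih (by omega)
    set j : Fin m := ⟨n, by omega⟩ with hj
    have hsucc : initialUnion C (n + 1) = initialUnion C n ∪ C j := initialUnion_succ j
    have hDU : D ⊆ initialUnion C n := fun v hv => by
      obtain ⟨l, hl, hv⟩ := mem_initialUnion.1 (mem_separator.1 hv).2
      exact mem_initialUnion.2 ⟨l, by omega, hv⟩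
    -- The old vertices of `C j` lie in the single earlier clique `C k`, so the new vertices of `C
    -- j` can join the side containing `C k`; they lie in no earlier clique, so disjointness
    -- persists.
    obtain ⟨k, hk, hDk⟩ := hC.running_intersection j (by simp only [hj]; omega)
    have hnew : Disjoint (initialUnion C n) (C j \ initialUnion C n) := Finset.disjoint_sdiff
    have hext : ∀ S : Finset V, C k ⊆ S ∪ D → C j ⊆ S ∪ (C j \ initialUnion C n) ∪ D := by
      intro S hS v hv
      by_cases hvU : v ∈ initialUnion C n
      · have := hS (hDk (mem_separator.2 ⟨hv, hvU⟩))
        simp only [Finset.mem_union] at this ⊢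
        tauto
      · simp [hv, hvU]
    have hmono : ∀ S : Finset V, S ∪ D ⊆ S ∪ (C j \ initialUnion C n) ∪ D := fun S =>
      Finset.union_subset_union_left Finset.subset_union_left
    have hlt : ∀ l : Fin m, l.val < n + 1 → l.val < n ∨ l = j := fun l hl => by
      rcases Nat.lt_succ_iff_lt_or_eq.1 hl with h | h
      · exact .inl h
      · exact .inr (Fin.ext h)
    have hbig : ∀ S : Finset V, S ⊆ initialUnion C n →
        S ∪ (C j \ initialUnion C n) ⊆ initialUnion C (n + 1) := by
      intro S hS
      rw [hsucc]
      exact Finset.union_subset_union hS Finset.sdiff_subset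
    have hstep : initialUnion C n ⊆ initialUnion C (n + 1) := by
      rw [hsucc]
      exact Finset.subset_union_left
    rcases hcov k hk with hkA | hkC
    · refine ⟨A' ∪ (C j \ initialUnion C n), C', hA.trans Finset.subset_union_left, hC',
        Finset.disjoint_union_left.2 ⟨hAC, (hnew.mono_left hCU).symm⟩,
        Finset.disjoint_union_left.2 ⟨hAD, (hnew.mono_left hDU).symm⟩, hCD, hbig A' hAU,
        hCU.trans hstep, fun l hl => ?_⟩
      rcases hlt l hl with h | rfl
      · exact (hcov l h).imp_left fun h => h.trans (hmono A')
      · exact .inl (hext A' hkA)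
    · refine ⟨A', C' ∪ (C j \ initialUnion C n), hA, hC'.trans Finset.subset_union_left,
        Finset.disjoint_union_right.2 ⟨hAC, hnew.mono_left hAU⟩, hAD,
        Finset.disjoint_union_left.2 ⟨hCD, (hnew.mono_left hDU).symm⟩, hAU.trans hstep,
        hbig C' hCU, fun l hl => ?_⟩
      rcases hlt l hl with h | rfl
      · exact (hcov l h).imp_right fun h => h.trans (hmono C')
      · exact .inr (hext C' hkC)

/-- Every edge lies in some clique, and every clique lies on one side of the separator, so no edge
crosses. -/
theorem IsCliqueSequence.exists_isSeparation [Fintype V] (hC : IsCliqueSequence G C) (i : Fin m) :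
    ∃ A' C' : Finset V, initialUnion C i.val \ separator C i ⊆ A' ∧
      C i \ separator C i ⊆ C' ∧ IsSeparation G A' (separator C i) C' := by
  obtain ⟨A', C', hA, hC', hAC, hAD, hCD, -, -, hcov⟩ :=
    hC.exists_sides i (n := m) (by omega) le_rfl
  refine ⟨A', C', hA, hC', hAD, hAC, hCD.symm, ?_, ?_⟩
  · ext v
    obtain ⟨j, hj⟩ := hC.exists_subset (s := {v}) (by simp)
    have hv : v ∈ C j := hj (by simp)
    simp only [Finset.mem_union, Finset.mem_univ, iff_true]
    rcases hcov j j.2 with h | h <;> have := h hv <;> simp only [Finset.mem_union] at this <;> tauto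
  · intro a ha c hc hadj
    obtain ⟨j, hj⟩ := hC.exists_subset (s := {a, c}) (by
      simpa [SimpleGraph.isClique_pair] using fun _ => hadj)
    have haj : a ∈ C j := hj (by simp)
    have hcj : c ∈ C j := hj (by simp)
    rcases hcov j j.2 with h | h
    · have := h hcj
      rw [Finset.mem_union] at this
      exact this.elim (fun h => Finset.disjoint_left.1 hAC h hc)
        (fun h => Finset.disjoint_left.1 hCD hc h)
    · have := h haj
      rw [Finset.mem_union] at this
      exact this.elim (fun h => Finset.disjoint_left.1 hAC ha h)
        (fun h => Finset.disjoint_left.1 hAD ha h)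

theorem IsCliqueSequence.pos [Fintype V] (hC : IsCliqueSequence G C) : 0 < m := by
  obtain ⟨i, -⟩ := hC.exists_subset (s := ∅) (by simp)
  exact i.pos

theorem IsCliqueSequence.nonempty [Nonempty V] (hC : IsCliqueSequence G C) (i : Fin m) :
    (C i).Nonempty := by
  rw [Finset.nonempty_iff_ne_empty]
  intro h
  obtain ⟨v⟩ := ‹Nonempty V›
  have := ((hC.clique_iff _).1 ⟨i, rfl⟩).2 (y := {v}) (by simp) (by simp [h])
  simp [h] at this

/-- Telescoping along a clique sequence. -/
theorem IsCliqueSequence.mul_prod_separator [Fintype V] {M : Type*} [CommMonoid M]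
    (hC : IsCliqueSequence G C) (φ : Finset V → M)
    (hφ : ∀ i : Fin m, 0 < i.val →
      φ (initialUnion C (i.val + 1)) * φ (separator C i) = φ (initialUnion C i.val) * φ (C i)) :
    φ Finset.univ * ∏ i with 0 < i.val, φ (separator C i) = ∏ i, φ (C i) := by
  have key : ∀ n : ℕ, 1 ≤ n → n ≤ m →
      φ (initialUnion C n) * ∏ i : Fin m with (0 < i.val ∧ i.val < n), φ (separator C i) =
        ∏ i : Fin m with i.val < n, φ (C i) := by
    intro n hn
    induction n, hn using Nat.le_induction with
    | base =>
      intro h1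
      have e1 : (Finset.univ.filter fun i : Fin m => 0 < i.val ∧ i.val < 1) = ∅ := by
        ext i; simp; omega
      have e2 : (Finset.univ.filter fun i : Fin m => i.val < 1) = {⟨0, h1⟩} := by
        ext i; simp [Fin.ext_iff]
      rw [e1, e2, initialUnion, e2]
      simp
    | succ n hn ih =>
      intro h1
      set j : Fin m := ⟨n, by omega⟩ with hj
      have e1 : (Finset.univ.filter fun i : Fin m => 0 < i.val ∧ i.val < n + 1) =
          insert j (Finset.univ.filter fun i : Fin m => 0 < i.val ∧ i.val < n) := by
        ext i; simp [Fin.ext_iff, hj]; omega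
      have e2 : (Finset.univ.filter fun i : Fin m => i.val < n + 1) =
          insert j (Finset.univ.filter fun i : Fin m => i.val < n) := by
        ext i; simp [Fin.ext_iff, hj]; omega
      rw [e1, e2, Finset.prod_insert (by simp [hj]), Finset.prod_insert (by simp [hj]),
        ← ih (by omega), ← mul_assoc, hφ j (by simp only [hj]; omega)]
      rw [mul_comm (φ (initialUnion C j.val)), mul_assoc]
  have := key m hC.pos le_rfl
  rw [hC.initialUnion_eq_univ] at this
  simpa using this

end Graphs

/-! ### The spaces and measures determined by distribution functions -/

section Spaces

variable {d : ℕ}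

theorem openOrthant_eq_pi : openOrthant d = univ.pi fun _ => Ioi (0 : ℝ) := by
  ext y; simp [openOrthant]

theorem isOpen_openOrthant : IsOpen (openOrthant d) := by
  rw [openOrthant_eq_pi]
  exact isOpen_set_pi finite_univ fun _ _ => isOpen_Ioi

theorem measurableSet_openOrthant : MeasurableSet (openOrthant d) :=
  isOpen_openOrthant.measurableSet

theorem measurableSet_cone : MeasurableSet (cone d) :=
  (isClosed_Ici (a := (0 : Fin d → ℝ))).measurableSet.inter (measurableSet_singleton 0).compl

theorem one_mem_openOrthant : (1 : Fin d → ℝ) ∈ openOrthant d := fun _ => one_pos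

theorem smul_mem_openOrthant {t : ℝ} (ht : 0 < t) {y : Fin d → ℝ} (hy : y ∈ openOrthant d) :
    t • y ∈ openOrthant d := fun i => mul_pos ht (hy i)

theorem inf_mem_openOrthant {y z : Fin d → ℝ} (hy : y ∈ openOrthant d) (hz : z ∈ openOrthant d) :
    y ⊓ z ∈ openOrthant d := fun i => lt_min (hy i) (hz i)

theorem openOrthant_subset_cone [Nonempty (Fin d)] : openOrthant d ⊆ cone d := by
  intro y hy
  refine ⟨fun i => (hy i).le, ?_⟩
  rintro rfl
  exact lt_irrefl _ (hy (Classical.arbitrary _))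

theorem cone_ae_eq_openOrthant [Nonempty (Fin d)] :
    cone d =ᵐ[(volume : Measure (Fin d → ℝ))] openOrthant d := by
  have h : (univ.pi fun _ : Fin d => Ioi (0 : ℝ)) =ᵐ[volume] Ici (0 : Fin d → ℝ) :=
    Measure.univ_pi_Ioi_ae_eq_Ici (μ := fun _ : Fin d => (volume : Measure ℝ)) (f := 0)
  rw [← openOrthant_eq_pi] at h
  refine Filter.EventuallyLE.antisymm ?_ openOrthant_subset_cone.eventuallyLE
  exact (LE.le.eventuallyLE (fun y hy => hy.1 : cone d ⊆ Ici 0)).trans h.symm.le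

theorem lSpace_eq : lSpace d = cone d \ Icc 0 1 := by
  ext x
  simp only [lSpace, mem_ofPred_eq, mem_sdiff, mem_Icc, not_and]
  refine and_congr_right fun hx => ?_
  have h1 : 1 < ‖x‖ ↔ ¬ ‖x‖ ≤ 1 := not_le.symm
  rw [h1, pi_norm_le_iff_of_nonneg zero_le_one]
  have h0 : 0 ≤ x := hx.1
  simp only [h0, true_imp_iff, Pi.le_def, Pi.one_apply]
  refine not_congr (forall_congr' fun i => ?_)
  rw [Real.norm_of_nonneg (h0 i)]

theorem measurableSet_lSpace : MeasurableSet (lSpace d) := by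
  rw [lSpace_eq]
  exact measurableSet_cone.diff measurableSet_Icc

theorem mem_lSpace_of_one_lt {y : Fin d → ℝ} (hy : y ∈ openOrthant d) {k : Fin d} (hk : 1 < y k) :
    y ∈ lSpace d := by
  have : Nonempty (Fin d) := ⟨k⟩
  rw [lSpace_eq]
  exact ⟨openOrthant_subset_cone hy, fun h => absurd (h.2 k) (not_le.2 hk)⟩

theorem isOpen_openOrthant_diff_Icc {z : Fin d → ℝ} : IsOpen (openOrthant d \ Icc 0 z) :=
  isOpen_openOrthant.sdiff isClosed_Icc

theorem lSpace_inter_openOrthant [Nonempty (Fin d)] :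
    lSpace d ∩ openOrthant d = openOrthant d \ Icc 0 1 := by
  rw [lSpace_eq]
  ext y
  have := @openOrthant_subset_cone d _ y
  simp only [mem_inter_iff, mem_sdiff]
  tauto

/-- Finite measures on the closed orthant are determined by their distribution function on the
open orthant. -/
theorem measure_ext_of_Iic_openOrthant {μ ν : Measure (Fin d → ℝ)} [IsFiniteMeasure μ]
    [IsFiniteMeasure ν] (hμ : μ (Ici 0)ᶜ = 0) (hν : ν (Ici 0)ᶜ = 0)
    (h : ∀ z ∈ openOrthant d, μ (Iic z) = ν (Iic z)) : μ = ν := by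
  have hall : ∀ z, μ (Iic z) = ν (Iic z) := by
    intro z
    by_cases hz : 0 ≤ z
    -- Zero coordinates of `z` are reached from inside the open orthant by continuity from above.
    · have hanti : Antitone fun n : ℕ => Iic (z + fun _ : Fin d => 1 / ((n : ℝ) + 1)) := by
        intro m n hmn
        refine Iic_subset_Iic.2 fun i => ?_
        simp only [Pi.add_apply]
        gcongr
      have hInter : Iic z = ⋂ n : ℕ, Iic (z + fun _ : Fin d => 1 / ((n : ℝ) + 1)) := by
        ext x
        simp only [mem_Iic, mem_iInter]
        constructor
        · intro hx n i
          have : 0 ≤ 1 / ((n : ℝ) + 1) := by positivity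
          exact (hx i).trans (le_add_of_nonneg_right this)
        · intro hx i
          refine le_of_forall_pos_le_add fun ε hε => ?_
          obtain ⟨n, hn⟩ := exists_nat_one_div_lt hε
          exact (hx n i).trans (add_le_add_right hn.le _)
      have hm := tendsto_measure_iInter_atTop (μ := μ)
        (fun n : ℕ => (measurableSet_Iic
          (a := z + fun _ : Fin d => 1 / ((n : ℝ) + 1))).nullMeasurableSet)
        hanti ⟨0, measure_ne_top _ _⟩
      have hn := tendsto_measure_iInter_atTop (μ := ν)
        (fun n : ℕ => (measurableSet_Iic
          (a := z + fun _ : Fin d => 1 / ((n : ℝ) + 1))).nullMeasurableSet)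
        hanti ⟨0, measure_ne_top _ _⟩
      rw [← hInter] at hm hn
      refine tendsto_nhds_unique hm (hn.congr fun n => (h _ fun i => ?_).symm)
      have : 0 < 1 / ((n : ℝ) + 1) := by positivity
      exact add_pos_of_nonneg_of_pos (hz i) this
    · have : Iic z ⊆ (Ici 0)ᶜ := fun x hx h0 => hz (le_trans h0 hx)
      rw [measure_mono_null this hμ, measure_mono_null this hν]
  have huniv : μ univ = ν univ := by
    have hmono : Monotone fun n : ℕ => Iic (fun _ : Fin d => (n : ℝ)) := by
      intro m n hmn
      refine Iic_subset_Iic.2 fun i => ?_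
      exact Nat.cast_le.2 hmn
    have hUnion : (⋃ n : ℕ, Iic (fun _ : Fin d => (n : ℝ))) = univ := by
      refine eq_univ_of_forall fun x => mem_iUnion.2 ?_
      obtain ⟨n, hn⟩ := exists_nat_ge ‖x‖
      exact ⟨n, fun i => (le_abs_self _).trans ((norm_le_pi_norm x i).trans hn)⟩
    have hm := tendsto_measure_iUnion_atTop (μ := μ) hmono
    have hn := tendsto_measure_iUnion_atTop (μ := ν) hmono
    rw [hUnion] at hm hn
    exact tendsto_nhds_unique hm (hn.congr fun n => (hall _).symm)
  have hgen : ∀ _ : Fin d, IsCountablySpanning (range (Iic : ℝ → Set ℝ)) := fun _ => by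
    refine ⟨fun n : ℕ => Iic (n : ℝ), fun n => mem_range_self _, ?_⟩
    exact iUnion_Iic_of_not_bddAbove_range (by
      rw [not_bddAbove_iff]
      intro x
      obtain ⟨n, hn⟩ := exists_nat_gt x
      exact ⟨n, mem_range_self n, hn⟩)
  refine ext_of_generate_finite (univ.pi '' univ.pi fun _ : Fin d => range (Iic : ℝ → Set ℝ))
    ?_ (IsPiSystem.pi fun _ => isPiSystem_image_Iic univ |> (by simpa using ·)) ?_ huniv
  · refine Eq.trans ?_ (generateFrom_pi_eq hgen)
    congr 1
    ext i : 1
    rw [← borel_eq_generateFrom_Iic]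
    exact BorelSpace.measurable_eq
  · rintro _ ⟨s, hs, rfl⟩
    choose z hz using fun i => hs i (mem_univ i)
    have : univ.pi s = Iic z := by
      rw [← pi_univ_Iic]
      exact pi_congr rfl fun i _ => (hz i).symm
    rw [this, hall]

theorem measure_diff_Icc_inter_Iic {Λ : Measure (Fin d → ℝ)}
    (hfin : ∀ z ∈ openOrthant d, expo Λ z ≠ ∞) {z₀ z : Fin d → ℝ} (hz : z ∈ openOrthant d) :
    Λ ((cone d \ Icc 0 z₀) ∩ Iic z) = expo Λ (z ⊓ z₀) - expo Λ z := by
  have : (cone d \ Icc 0 z₀) ∩ Iic z = (cone d \ Icc 0 (z ⊓ z₀)) \ (cone d \ Icc 0 z) := by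
    ext x
    simp only [mem_inter_iff, mem_sdiff, mem_Icc, mem_Iic, le_inf_iff]
    have : x ∈ cone d → 0 ≤ x := fun h => h.1
    tauto
  rw [this, measure_sdiff _ (measurableSet_cone.diff measurableSet_Icc).nullMeasurableSet
    (hfin z hz)]
  · rfl
  · exact sdiff_subset_sdiff_right (Icc_subset_Icc_right inf_le_left)

/-- Uniqueness from distribution functions applies only after cutting out a box at the origin, since
an exponent measure may have infinite total mass. -/
theorem restrict_diff_Icc_eq {Λ Λ' : Measure (Fin d → ℝ)}
    (hfin : ∀ z ∈ openOrthant d, expo Λ z ≠ ∞) (h : ∀ z ∈ openOrthant d, expo Λ' z = expo Λ z)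
    {z₀ : Fin d → ℝ} (hz₀ : z₀ ∈ openOrthant d) :
    Λ'.restrict (cone d \ Icc 0 z₀) = Λ.restrict (cone d \ Icc 0 z₀) := by
  have hm : MeasurableSet (cone d \ Icc 0 z₀) := measurableSet_cone.diff measurableSet_Icc
  have hsub : (Ici (0 : Fin d → ℝ))ᶜ ∩ (cone d \ Icc 0 z₀) = ∅ := by
    ext x
    simp only [mem_inter_iff, mem_compl_iff, mem_Ici, mem_sdiff, mem_empty_iff_false, iff_false]
    exact fun hx => hx.1 hx.2.1.1
  have hfin' : ∀ z ∈ openOrthant d, expo Λ' z ≠ ∞ := fun z hz => h z hz ▸ hfin z hz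
  have : IsFiniteMeasure (Λ.restrict (cone d \ Icc 0 z₀)) :=
    ⟨by rw [Measure.restrict_apply_univ]; exact (hfin z₀ hz₀).lt_top⟩
  have : IsFiniteMeasure (Λ'.restrict (cone d \ Icc 0 z₀)) :=
    ⟨by rw [Measure.restrict_apply_univ]; exact (hfin' z₀ hz₀).lt_top⟩
  refine measure_ext_of_Iic_openOrthant ?_ ?_ fun z hz => ?_
  · rw [Measure.restrict_apply measurableSet_Ici.compl, hsub, measure_empty]
  · rw [Measure.restrict_apply measurableSet_Ici.compl, hsub, measure_empty]
  · rw [Measure.restrict_apply measurableSet_Iic, Measure.restrict_apply measurableSet_Iic,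
      inter_comm, measure_diff_Icc_inter_Iic hfin' hz, measure_diff_Icc_inter_Iic hfin hz,
      h _ (inf_mem_openOrthant hz hz₀), h z hz]

end Spaces

/-! ### Multivariate Pareto laws and exponent measures -/

section Pareto

variable {d : ℕ} {P Λ : Measure (Fin d → ℝ)}

theorem IsMultivariatePareto.nonempty (hP : IsMultivariatePareto P Λ) : Nonempty (Fin d) := by
  by_contra h
  have := hP.isProbabilityMeasure
  rw [not_nonempty_iff] at h
  have h1 : lSpace d = ∅ := by
    ext x
    simp only [lSpace, cone, mem_ofPred_eq, mem_empty_iff_false, iff_false]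
    exact fun hx => hx.1.2 (Subsingleton.elim _ _)
  have h2 := hP.compl_lSpace
  rw [h1, compl_empty, measure_univ] at h2
  exact one_ne_zero h2

theorem IsMultivariatePareto.expo_one_ne_top (hP : IsMultivariatePareto P Λ) : expo Λ 1 ≠ ∞ :=
  hP.isExponentMeasure.finite 1 one_mem_openOrthant

theorem IsMultivariatePareto.expo_one_ne_zero (hP : IsMultivariatePareto P Λ) :
    expo Λ 1 ≠ 0 := by
  intro h0
  have := hP.isProbabilityMeasure
  have hnull : ∀ n : ℕ, P (Iic (fun _ : Fin d => (n : ℝ) + 1)) = 0 := fun n => by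
    -- With zero denominator the quotient is `0` by convention, so `P` would vanish on boxes
    -- exhausting the space.
    have h1 := hP.cdf (fun _ : Fin d => (n : ℝ) + 1)
      (fun _ => show (0 : ℝ) < (n : ℝ) + 1 by positivity)
    rw [h0, ENNReal.toReal_zero, div_zero] at h1
    rwa [measureReal_eq_zero_iff] at h1
  have hUnion : (⋃ n : ℕ, Iic (fun _ : Fin d => (n : ℝ) + 1)) = univ := by
    refine eq_univ_of_forall fun x => mem_iUnion.2 ?_
    obtain ⟨n, hn⟩ := exists_nat_ge ‖x‖
    exact ⟨n, fun i => ((le_abs_self _).trans ((norm_le_pi_norm x i).trans hn)).trans (by simp)⟩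
  have h2 := measure_iUnion_null hnull
  rw [hUnion, measure_univ] at h2
  exact one_ne_zero h2

/-- On `Iic z`, leaving `[0, 1]` amounts to leaving `[0, z ⊓ 1]`, so the prescribed distribution
function is exactly that of `Λ` restricted to the L-shaped space and normalized. -/
theorem IsMultivariatePareto.eq_smul_restrict (hP : IsMultivariatePareto P Λ) :
    P = (expo Λ 1)⁻¹ • Λ.restrict (lSpace d) := by
  have := hP.isProbabilityMeasure
  have hfin := hP.isExponentMeasure.finite
  have hL : (Ici (0 : Fin d → ℝ))ᶜ ⊆ (lSpace d)ᶜ := compl_subset_compl.2 fun x hx => hx.1.1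
  have hfinL : IsFiniteMeasure ((expo Λ 1)⁻¹ • Λ.restrict (lSpace d)) := by
    have : IsFiniteMeasure (Λ.restrict (lSpace d)) :=
      ⟨by rw [Measure.restrict_apply_univ, lSpace_eq]; exact hP.expo_one_ne_top.lt_top⟩
    exact Measure.smul_finite _ (ENNReal.inv_ne_top.2 hP.expo_one_ne_zero)
  refine measure_ext_of_Iic_openOrthant (measure_mono_null hL hP.compl_lSpace) ?_ fun z hz => ?_
  · rw [Measure.smul_apply, Measure.restrict_apply measurableSet_Ici.compl]
    have : (Ici (0 : Fin d → ℝ))ᶜ ∩ lSpace d = ∅ := by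
      ext x
      simp only [mem_inter_iff, mem_empty_iff_false, iff_false]
      exact fun hx => hL hx.1 hx.2
    rw [this, measure_empty, smul_zero]
  · rw [← ENNReal.toReal_eq_toReal_iff' (measure_ne_top _ _) (measure_ne_top _ _)]
    have h1 := hP.cdf z hz
    rw [measureReal_def] at h1
    rw [h1, Measure.smul_apply, Measure.restrict_apply measurableSet_Iic, inter_comm, lSpace_eq,
      measure_diff_Icc_inter_Iic hfin hz, smul_eq_mul, ENNReal.toReal_mul, ENNReal.toReal_inv,
      ENNReal.toReal_sub_of_le _ (hfin _ (inf_mem_openOrthant hz one_mem_openOrthant)),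
      div_eq_inv_mul]
    exact measure_mono (sdiff_subset_sdiff_right (Icc_subset_Icc_right inf_le_left))

theorem IsExponentMeasure.expo_nsmul (hΛ : IsExponentMeasure Λ) {n : ℕ} (hn : 0 < n)
    {z : Fin d → ℝ} (hz : z ∈ openOrthant d) :
    (n : ℝ≥0∞) * expo Λ ((n : ℝ) • z) = expo Λ z := by
  obtain ⟨μ, hμ, hexp⟩ := hΛ.exists_maxStable
  have hnz : (n : ℝ) • z ∈ openOrthant d := smul_mem_openOrthant (by exact_mod_cast hn) hz
  have h1 := hμ.max_stable n hn z
  rw [hexp _ hnz, hexp _ hz, ← Real.exp_nat_mul, Real.exp_eq_exp, mul_neg, neg_inj] at h1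
  rw [← ENNReal.toReal_eq_toReal_iff' (ENNReal.mul_ne_top (by simp) (hΛ.finite _ hnz))
    (hΛ.finite _ hz), ENNReal.toReal_mul]
  simpa using h1

theorem lintegral_comp_smul {ι : Type*} [Fintype ι] {g : (ι → ℝ) → ℝ≥0∞} (hg : Measurable g)
    {t : ℝ} (ht : 0 < t) :
    ∫⁻ y, g (t • y) = ENNReal.ofReal ((t ^ Fintype.card ι)⁻¹) * ∫⁻ y, g y := by
  have h1 : ∫⁻ y, g (t • y) = ∫⁻ y, g y ∂(Measure.map (t • ·) volume) :=
    (lintegral_map hg (measurable_const_smul t)).symm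
  rw [h1, Measure.map_addHaar_smul volume ht.ne', lintegral_smul_measure, Module.finrank_pi,
    abs_of_pos (by positivity), smul_eq_mul]

end Pareto

/-! ### Densities of exponent measures -/

section Density

variable {d : ℕ} {lam : (Fin d → ℝ) → ℝ}

/-- The `[0,∞]`-valued density that agrees with `lam` on the open orthant and vanishes elsewhere. -/
noncomputable def orthantDensity (lam : (Fin d → ℝ) → ℝ) : (Fin d → ℝ) → ℝ≥0∞ :=
  (openOrthant d).indicator fun y => ENNReal.ofReal (lam y)

theorem orthantDensity_of_mem {y : Fin d → ℝ} (hy : y ∈ openOrthant d) :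
    orthantDensity lam y = ENNReal.ofReal (lam y) := indicator_of_mem hy _

theorem orthantDensity_of_notMem {y : Fin d → ℝ} (hy : y ∉ openOrthant d) :
    orthantDensity lam y = 0 := indicator_of_notMem hy _

theorem measurable_orthantDensity (hlam : ContinuousOn lam (openOrthant d)) :
    Measurable (orthantDensity lam) := by
  classical
  have h : ContinuousOn (fun y => ENNReal.ofReal (lam y)) (openOrthant d) :=
    ENNReal.continuous_ofReal.comp_continuousOn hlam
  rw [orthantDensity, ← piecewise_eq_indicator]
  exact h.measurable_piecewise continuousOn_const measurableSet_openOrthant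

theorem withDensity_restrict_cone [Nonempty (Fin d)] :
    (volume.restrict (cone d)).withDensity (fun y => ENNReal.ofReal (lam y)) =
      volume.withDensity (orthantDensity lam) := by
  rw [Measure.restrict_congr_set cone_ae_eq_openOrthant, orthantDensity,
    withDensity_indicator measurableSet_openOrthant]

/-- What makes `lam` the density of an exponent measure: continuity, positivity, homogeneity,
and finite mass away from the origin. -/
structure IsExponentDensity (lam : (Fin d → ℝ) → ℝ) : Prop where
  continuousOn : ContinuousOn lam (openOrthant d)
  pos : ∀ y ∈ openOrthant d, 0 < lam y
  homogeneous : ∀ t : ℝ, 0 < t → ∀ y ∈ openOrthant d, lam (t • y) = (t ^ (d + 1))⁻¹ * lam y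
  tail : ∀ (k : Fin d) (ε : ℝ), 0 < ε →
    ∫⁻ y in {y : Fin d → ℝ | ε < y k}, orthantDensity lam y ≠ ∞

variable {Λ : Measure (Fin d → ℝ)}

/-- The right side is the density of `s ↦ n Λ(n s)`, with `n ^ d` from the change of variables and
one more `n` from the factor. By max-stability this measure has the same `expo` as `Λ`, so the
densities agree almost everywhere away from the origin, and by continuity everywhere in the open
orthant. -/
theorem IsExponentMeasure.ofReal_density_nsmul [Nonempty (Fin d)] (hΛ : IsExponentMeasure Λ)
    (hlam : Λ = volume.withDensity (orthantDensity lam))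
    (hcont : ContinuousOn lam (openOrthant d)) {n : ℕ} (hn : 0 < n) {y : Fin d → ℝ}
    (hy : y ∈ openOrthant d) :
    ENNReal.ofReal (lam y) = ENNReal.ofReal ((n : ℝ) ^ (d + 1)) *
      ENNReal.ofReal (lam ((n : ℝ) • y)) := by
  have hn' : (0 : ℝ) < n := by exact_mod_cast hn
  have hmeas := measurable_orthantDensity hcont
  set h₁ : (Fin d → ℝ) → ℝ≥0∞ := fun x =>
    ENNReal.ofReal ((n : ℝ) ^ (d + 1)) * orthantDensity lam ((n : ℝ) • x) with hh₁
  have hmeas₁ : Measurable h₁ := (hmeas.comp (measurable_const_smul _)).const_mul _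
  have hmass : ∀ s : Set (Fin d → ℝ), MeasurableSet s →
      volume.withDensity h₁ s = n * Λ ((fun x => (n : ℝ)⁻¹ • x) ⁻¹' s) := by
    intro s hs
    have hs' : MeasurableSet ((fun x : Fin d → ℝ => (n : ℝ)⁻¹ • x) ⁻¹' s) :=
      measurable_const_smul (n : ℝ)⁻¹ hs
    rw [withDensity_apply _ hs, hlam, withDensity_apply _ hs', ← lintegral_indicator hs,
      ← lintegral_indicator hs']
    have hG : Measurable (((fun x : Fin d → ℝ => (n : ℝ)⁻¹ • x) ⁻¹' s).indicator
        (orthantDensity lam)) := hmeas.indicator hs'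
    have e1 : ∀ x, s.indicator h₁ x = ENNReal.ofReal ((n : ℝ) ^ (d + 1)) *
        ((fun x : Fin d → ℝ => (n : ℝ)⁻¹ • x) ⁻¹' s).indicator (orthantDensity lam)
          ((n : ℝ) • x) := by
      intro x
      by_cases hx : x ∈ s
      · rw [indicator_of_mem hx, indicator_of_mem]
        simpa [smul_smul, hn'.ne'] using hx
      · rw [indicator_of_notMem hx, indicator_of_notMem, mul_zero]
        simpa [smul_smul, hn'.ne'] using hx
    have hGn : Measurable fun x => ((fun x : Fin d → ℝ => (n : ℝ)⁻¹ • x) ⁻¹' s).indicator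
        (orthantDensity lam) ((n : ℝ) • x) := hG.comp (measurable_const_smul _)
    simp_rw [e1]
    rw [lintegral_const_mul _ hGn, lintegral_comp_smul hG hn',
      ← mul_assoc, ← ENNReal.ofReal_mul (by positivity), Fintype.card_fin]
    congr 1
    rw [pow_succ, mul_comm ((n : ℝ) ^ d), mul_assoc, mul_inv_cancel₀ (by positivity), mul_one,
      ENNReal.ofReal_natCast]
  have hexpo : ∀ z ∈ openOrthant d, expo (volume.withDensity h₁) z = expo Λ z := by
    intro z hz
    rw [expo, hmass _ (measurableSet_cone.diff measurableSet_Icc), ← hΛ.expo_nsmul hn hz, expo]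
    congr 2
    ext x
    simp only [mem_preimage, mem_sdiff, cone, mem_ofPred_eq, mem_Icc, Pi.le_def, Pi.zero_apply,
      Pi.smul_apply, smul_eq_mul, ne_eq, smul_eq_zero, inv_eq_zero, hn'.ne', false_or,
      inv_mul_le_iff₀ hn', mul_nonneg_iff_of_pos_left (inv_pos.2 hn')]
  -- Halving puts `y` outside the removed box `[0, z₀]`.
  set z₀ : Fin d → ℝ := (2 : ℝ)⁻¹ • y with hz₀
  have hz₀m : z₀ ∈ openOrthant d := smul_mem_openOrthant (by norm_num) hy
  have hrestr := restrict_diff_Icc_eq hΛ.finite hexpo hz₀m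
  have hm : MeasurableSet (cone d \ Icc 0 z₀) := measurableSet_cone.diff measurableSet_Icc
  rw [hlam, restrict_withDensity hm, restrict_withDensity hm,
    withDensity_eq_iff_of_sigmaFinite hmeas₁.aemeasurable hmeas.aemeasurable] at hrestr
  have hO := ae_restrict_of_ae_restrict_of_subset
    (sdiff_subset_sdiff_left (openOrthant_subset_cone (d := d)) (t := Icc 0 z₀)) hrestr
  have c0 : ContinuousOn (fun y => ENNReal.ofReal (lam y)) (openOrthant d) :=
    ENNReal.continuous_ofReal.comp_continuousOn hcont
  have c1 : ContinuousOn (fun y => ENNReal.ofReal ((n : ℝ) ^ (d + 1)) *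
      ENNReal.ofReal (lam ((n : ℝ) • y))) (openOrthant d) := by
    refine (ENNReal.continuous_const_mul ENNReal.ofReal_ne_top).comp_continuousOn ?_
    exact c0.comp (continuous_const_smul _).continuousOn fun x hx => smul_mem_openOrthant hn' hx
  have heq := Measure.eqOn_open_of_ae_eq (μ := (volume : Measure (Fin d → ℝ)))
    (U := openOrthant d \ Icc 0 z₀)
    (f := fun y => ENNReal.ofReal ((n : ℝ) ^ (d + 1)) * ENNReal.ofReal (lam ((n : ℝ) • y)))
    (g := fun y => ENNReal.ofReal (lam y)) (by
      filter_upwards [hO, self_mem_ae_restrict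
        (isOpen_openOrthant_diff_Icc (z := z₀)).measurableSet] with x hx hxO
      rwa [orthantDensity_of_mem hxO.1, hh₁,
        show (fun x => _) x = _ from rfl,
        orthantDensity_of_mem (smul_mem_openOrthant hn' hxO.1)] at hx)
    isOpen_openOrthant_diff_Icc (c1.mono sdiff_subset) (c0.mono sdiff_subset)
  refine (heq ⟨hy, fun hle => ?_⟩).symm
  have h1 := hle.2 (Classical.arbitrary _)
  have h2 := hy (Classical.arbitrary (Fin d))
  simp only [hz₀, Pi.smul_apply, smul_eq_mul] at h1
  linarith

theorem ofReal_density_eq [Nonempty (Fin d)] {P : Measure (Fin d → ℝ)} {f : (Fin d → ℝ) → ℝ}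
    (hP : IsMultivariatePareto P Λ)
    (hf : P = (volume.restrict (lSpace d)).withDensity (fun y => ENNReal.ofReal (f y)))
    (hf_cont : ContinuousOn f (lSpace d ∩ openOrthant d))
    (hlam : Λ = volume.withDensity (orthantDensity lam))
    (hcont : ContinuousOn lam (openOrthant d)) {y : Fin d → ℝ}
    (hy : y ∈ lSpace d ∩ openOrthant d) :
    ENNReal.ofReal (f y) = (expo Λ 1)⁻¹ * ENNReal.ofReal (lam y) := by
  have hO : IsOpen (lSpace d ∩ openOrthant d) := by
    rw [lSpace_inter_openOrthant]; exact isOpen_openOrthant_diff_Icc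
  have h1 := congrArg (fun μ => Measure.restrict μ (lSpace d ∩ openOrthant d))
    (hf.symm.trans hP.eq_smul_restrict)
  have cf : ContinuousOn (fun y => ENNReal.ofReal (f y)) (lSpace d ∩ openOrthant d) :=
    ENNReal.continuous_ofReal.comp_continuousOn hf_cont
  have cl : ContinuousOn (fun y => (expo Λ 1)⁻¹ * ENNReal.ofReal (lam y))
      (lSpace d ∩ openOrthant d) :=
    (ENNReal.continuous_const_mul (ENNReal.inv_ne_top.2 hP.expo_one_ne_zero)).comp_continuousOn
      ((ENNReal.continuous_ofReal.comp_continuousOn hcont).mono inter_subset_right)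
  have hmeas := measurable_orthantDensity hcont
  rw [Measure.restrict_smul, Measure.restrict_restrict_of_subset inter_subset_left, hlam,
    restrict_withDensity hO.measurableSet, restrict_withDensity hO.measurableSet,
    Measure.restrict_restrict_of_subset inter_subset_left,
    ← withDensity_smul _ hmeas, withDensity_eq_iff_of_sigmaFinite
      (cf.aemeasurable hO.measurableSet) (hmeas.const_smul _).aemeasurable, ← hlam] at h1
  exact Measure.eqOn_open_of_ae_eq (by
    filter_upwards [h1, self_mem_ae_restrict hO.measurableSet] with x hx hxO
    rwa [Pi.smul_apply, orthantDensity_of_mem hxO.2] at hx) hO cf cl hy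

theorem exists_nat_smul_apply_gt_one {y : Fin d → ℝ} (hy : y ∈ openOrthant d) (k : Fin d) :
    ∃ n : ℕ, 0 < n ∧ 1 < ((n : ℝ) • y) k := by
  obtain ⟨n, hn⟩ := exists_nat_gt (y k)⁻¹
  have hk := hy k
  have hn0 : (0 : ℝ) < n := (inv_pos.2 hk).trans hn
  refine ⟨n, by exact_mod_cast hn0, ?_⟩
  rw [Pi.smul_apply, smul_eq_mul]
  exact (inv_lt_iff_one_lt_mul₀ hk).1 hn

/-- Homogeneity passes from integers to rationals algebraically and to reals by continuity.
Positivity is scaled back from the L-shaped space. The tails are finite because `{ε < y_k}` misses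
the box `[0, (ε, …, ε)]`. -/
theorem IsMultivariatePareto.isExponentDensity {P : Measure (Fin d → ℝ)} {f : (Fin d → ℝ) → ℝ}
    (hP : IsMultivariatePareto P Λ)
    (hf : P = (volume.restrict (lSpace d)).withDensity (fun y => ENNReal.ofReal (f y)))
    (hf_pos : ∀ y ∈ lSpace d ∩ openOrthant d, 0 < f y)
    (hf_cont : ContinuousOn f (lSpace d ∩ openOrthant d))
    (hlam : Λ = volume.withDensity (orthantDensity lam))
    (hcont : ContinuousOn lam (openOrthant d)) : IsExponentDensity lam := by
  have := hP.nonempty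
  have hΛ := hP.isExponentMeasure
  have k₀ := Classical.arbitrary (Fin d)
  have hpos : ∀ y ∈ openOrthant d, 0 < lam y := by
    intro y hy
    obtain ⟨n, hn, hny⟩ := exists_nat_smul_apply_gt_one hy k₀
    have hn' : (0 : ℝ) < n := by exact_mod_cast hn
    have hm := smul_mem_openOrthant hn' hy
    have hL : (n : ℝ) • y ∈ lSpace d ∩ openOrthant d := ⟨mem_lSpace_of_one_lt hm hny, hm⟩
    have h1 := ofReal_density_eq hP hf hf_cont hlam hcont hL
    have h2 := ENNReal.ofReal_pos.2 (hf_pos _ hL)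
    rw [h1] at h2
    have h3 := hΛ.ofReal_density_nsmul hlam hcont hn hy
    rw [← ENNReal.ofReal_pos, h3]
    exact ENNReal.mul_pos (ENNReal.ofReal_pos.2 (by positivity)).ne' 
      (right_ne_zero_of_mul h2.ne')
  have hnat : ∀ n : ℕ, 0 < n → ∀ y ∈ openOrthant d,
      lam y = (n : ℝ) ^ (d + 1) * lam ((n : ℝ) • y) := by
    intro n hn y hy
    have hn' : (0 : ℝ) < n := by exact_mod_cast hn
    have h3 := hΛ.ofReal_density_nsmul hlam hcont hn hy
    rw [← ENNReal.ofReal_mul (by positivity), ENNReal.ofReal_eq_ofReal_iff (hpos y hy).le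
      (mul_nonneg (by positivity) (hpos _ (smul_mem_openOrthant hn' hy)).le)] at h3
    exact h3
  have hrat : ∀ q : ℚ, 0 < q → ∀ y ∈ openOrthant d,
      lam y = (q : ℝ) ^ (d + 1) * lam ((q : ℝ) • y) := by
    intro q hq y hy
    have hq' : (0 : ℝ) < q := by exact_mod_cast hq
    have hb : (0 : ℝ) < (q.den : ℝ) := by exact_mod_cast q.den_pos
    have ha : 0 < q.num.toNat := by have := Rat.num_pos.2 hq; omega
    have hab : ((q.num.toNat : ℕ) : ℝ) = q.den * q := by
      have h1 : ((q.num.toNat : ℕ) : ℤ) = q.num := Int.toNat_of_nonneg (Rat.num_pos.2 hq).le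
      have h2 : (q.den : ℚ) * q = q.num := by rw [mul_comm]; exact Rat.mul_den_eq_num q
      have h3 : ((q.num.toNat : ℕ) : ℚ) = q.num := by exact_mod_cast h1
      rw [← h2] at h3
      exact_mod_cast h3
    have h1 := hnat _ ha y hy
    have h2 := hnat _ q.den_pos _ (smul_mem_openOrthant hq' hy)
    rw [smul_smul, ← hab] at h2
    rw [h1, h2, hab]
    ring
  have hreal : ∀ t : ℝ, 0 < t → ∀ y ∈ openOrthant d, lam y = t ^ (d + 1) * lam (t • y) := by
    intro t ht y hy
    have hcl : t ∈ closure (Ioi (0 : ℝ) ∩ range ((↑) : ℚ → ℝ)) :=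
      Rat.denseRange_cast.open_subset_closure_inter isOpen_Ioi ht
    have hc : ContinuousAt (fun s : ℝ => s ^ (d + 1) * lam (s • y)) t := by
      refine ((continuous_pow _).continuousAt).mul ?_
      refine ContinuousAt.comp (f := fun s : ℝ => s • y) (g := lam) ?_ ?_
      · exact hcont.continuousAt (isOpen_openOrthant.mem_nhds (smul_mem_openOrthant ht hy))
      · exact (continuous_id.smul continuous_const).continuousAt
    have hmem := mem_closure_iff_nhdsWithin_neBot.1 hcl
    have h1 := hc.tendsto.mono_left (nhdsWithin_le_nhds
      (s := Ioi (0 : ℝ) ∩ range ((↑) : ℚ → ℝ)))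
    refine tendsto_nhds_unique (tendsto_const_nhds.congr' ?_) h1
    filter_upwards [self_mem_nhdsWithin] with s hs
    obtain ⟨hs0, q, rfl⟩ := hs
    exact hrat q (Rat.cast_pos.1 (mem_Ioi.1 hs0)) y hy
  refine ⟨hcont, hpos, fun t ht y hy => ?_, fun k ε hε => ?_⟩
  · rw [hreal t ht y hy, inv_mul_cancel_left₀ (by positivity)]
  · have hmk : MeasurableSet {y : Fin d → ℝ | ε < y k} :=
      measurableSet_lt measurable_const (measurable_pi_apply k)
    rw [← withDensity_apply _ hmk, ← hlam]
    refine ne_top_of_le_ne_top (hΛ.finite (fun _ => ε) fun _ => hε) ?_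
    rw [← measure_inter_add_sdiff _ measurableSet_cone,
      measure_mono_null
        (fun x hx => hx.2 : {y : Fin d → ℝ | ε < y k} \ cone d ⊆ (cone d)ᶜ)
        hΛ.compl_cone, add_zero]
    refine measure_mono fun x hx => ⟨hx.2, fun h => ?_⟩
    exact absurd (h.2 k) (not_le.2 hx.1)

end Density

/-! ### Marginals of exponent measure densities -/

section ExpMarginal

variable {d : ℕ} {lam : (Fin d → ℝ) → ℝ}

/-- The boundary of the orthant is null in the integrated coordinates. The remaining coordinates of
`y` must be positive, since `orthantDensity` vanishes outside the open orthant and `lam` need not.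
-/
theorem expMarginal_eq {y : Fin d → ℝ} (hy : y ∈ openOrthant d) (I : Finset (Fin d)) :
    expMarginal lam I y = integrateOut Iᶜ (orthantDensity lam) y := by
  have hpi : Measure.pi (fun _ : (Iᶜ : Finset (Fin d)) => (volume : Measure ℝ).restrict (Ici 0)) =
      (volume : Measure ((Iᶜ : Finset (Fin d)) → ℝ)).restrict (univ.pi fun _ => Ioi 0) := by
    rw [volume_pi, ← Measure.restrict_pi_pi]
    refine Measure.restrict_congr_set ?_
    exact (Measure.pi_Ioi_ae_eq_pi_Ici
      (μ := fun _ : (Iᶜ : Finset (Fin d)) => (volume : Measure ℝ)) (f := fun _ => 0)).symm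
  have hm : MeasurableSet (univ.pi fun _ : (Iᶜ : Finset (Fin d)) => Ioi (0 : ℝ)) :=
    MeasurableSet.univ_pi fun _ => measurableSet_Ioi
  rw [expMarginal, lmarginal, hpi, integrateOut_apply, ← lintegral_indicator hm]
  refine lintegral_congr fun x => ?_
  have hiff : Function.updateFinset y Iᶜ x ∈ openOrthant d ↔
      x ∈ univ.pi fun _ : (Iᶜ : Finset (Fin d)) => Ioi (0 : ℝ) := by
    constructor
    · intro h i _
      have := h i.1
      simp only [Function.updateFinset, i.2, dite_true] at this
      exact this
    · intro h i
      by_cases hi : i ∈ Iᶜ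
      · simp only [Function.updateFinset, hi, dite_true]
        exact h ⟨i, hi⟩ (mem_univ _)
      · simp only [Function.updateFinset, hi, dite_false]
        exact hy i
  by_cases hx : x ∈ univ.pi fun _ : (Iᶜ : Finset (Fin d)) => Ioi (0 : ℝ)
  · rw [indicator_of_mem hx, orthantDensity_of_mem (hiff.2 hx)]
  · rw [indicator_of_notMem hx, orthantDensity_of_notMem (mt hiff.1 hx)]

namespace IsExponentDensity

theorem measurable (hl : IsExponentDensity lam) : Measurable (orthantDensity lam) :=
  measurable_orthantDensity hl.continuousOn

theorem integrateOut_orthantDensity_pos (hl : IsExponentDensity lam)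
    (s : Finset (Fin d)) {y : Fin d → ℝ}
    (hy : y ∈ openOrthant d) : 0 < integrateOut s (orthantDensity lam) y := by
  refine integrateOut_pos hl.measurable (fun _ => Ioi 0) (fun i => by simp) ?_ fun i _ => hy i
  intro z hz
  rw [orthantDensity_of_mem hz]
  exact ENNReal.ofReal_pos.2 (hl.pos z hz)

theorem orthantDensity_smul (hl : IsExponentDensity lam) {t : ℝ} (ht : 0 < t) (y : Fin d → ℝ) :
    orthantDensity lam (t • y) = ENNReal.ofReal ((t ^ (d + 1))⁻¹) * orthantDensity lam y := by
  by_cases hy : y ∈ openOrthant d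
  · rw [orthantDensity_of_mem hy, orthantDensity_of_mem (smul_mem_openOrthant ht hy),
      hl.homogeneous t ht y hy, ENNReal.ofReal_mul (by positivity)]
  · rw [orthantDensity_of_notMem hy, orthantDensity_of_notMem, mul_zero]
    intro h
    have := smul_mem_openOrthant (inv_pos.2 ht) h
    rw [smul_smul, inv_mul_cancel₀ ht.ne', one_smul] at this
    exact hy this

/-- The density contributes `t ^ (-(d + 1))` and rescaling the integrated coordinates contributes `t
^ (d - |I|)`. -/
theorem integrateOut_orthantDensity_smul (hl : IsExponentDensity lam)
    (I : Finset (Fin d)) {t : ℝ} (ht : 0 < t)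
    (y : Fin d → ℝ) :
    integrateOut Iᶜ (orthantDensity lam) (t • y) =
      ENNReal.ofReal (t ^ (-((I.card : ℤ) + 1))) * integrateOut Iᶜ (orthantDensity lam) y := by
  have hle : I.card ≤ d := by simpa using I.card_le_univ
  have h1 := lintegral_comp_smul (hl.measurable.comp_updateFinset (s := Iᶜ) (t • y)) ht
  have h2 : ∀ x : (Iᶜ : Finset (Fin d)) → ℝ,
      orthantDensity lam (Function.updateFinset (t • y) Iᶜ (t • x)) =
        ENNReal.ofReal ((t ^ (d + 1))⁻¹) * orthantDensity lam (Function.updateFinset y Iᶜ x) := by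
    intro x
    rw [← hl.orthantDensity_smul ht]
    congr 1
    ext i
    by_cases hi : i ∈ I <;> simp [Function.updateFinset, hi]
  simp_rw [h2] at h1
  rw [lintegral_const_mul _ (hl.measurable.comp_updateFinset y), ← integrateOut_apply,
    ← integrateOut_apply, Fintype.card_coe, Finset.card_compl, Fintype.card_fin] at h1
  have h3 := congrArg (fun u => ENNReal.ofReal (t ^ (d - I.card)) * u) h1
  simp only [← mul_assoc] at h3
  rw [← ENNReal.ofReal_mul (by positivity), ← ENNReal.ofReal_mul (by positivity),
    mul_inv_cancel₀ (by positivity), ENNReal.ofReal_one, one_mul] at h3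
  rw [← h3]
  congr 2
  rw [← zpow_natCast, ← zpow_natCast, ← zpow_neg, ← zpow_add₀ ht.ne']
  congr 1
  push_cast [Nat.cast_sub hle]
  ring

/-- Homogeneity with `t = 2` and `I = ∅` says that the total mass equals half of itself, while it is
positive. -/
theorem integrateOut_univ_eq_top (hl : IsExponentDensity lam) (y : Fin d → ℝ) :
    integrateOut Finset.univ (orthantDensity lam) y = ∞ := by
  by_contra hne
  have h1 := hl.integrateOut_orthantDensity_smul ∅ (t := 2) two_pos 1
  have h2 : ∀ z : Fin d → ℝ, integrateOut Finset.univ (orthantDensity lam) z =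
      integrateOut Finset.univ (orthantDensity lam) y := fun z =>
    integrateOut_congr _ fun i hi => absurd (Finset.mem_univ i) hi
  have h3 := hl.integrateOut_orthantDensity_pos Finset.univ one_mem_openOrthant
  rw [h2] at h3
  rw [Finset.compl_empty, h2, h2 1] at h1
  have h4 := congrArg ENNReal.toReal h1
  rw [ENNReal.toReal_mul, ENNReal.toReal_ofReal (by positivity)] at h4
  have h5 := ENNReal.toReal_pos h3.ne' hne
  norm_num at h4
  linarith

/-- For `i ∈ I` the cut-off `y_i > 1 / (n + 1)` commutes with integrating out `Iᶜ` and leaves finite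
mass; countably many cut-offs exhaust the orthant. -/
theorem integrateOut_orthantDensity_ne_top_ae (hl : IsExponentDensity lam)
    {I : Finset (Fin d)} (hI : I.Nonempty) :
    ∀ᵐ y : Fin d → ℝ, y ∈ openOrthant d → integrateOut Iᶜ (orthantDensity lam) y ≠ ∞ := by
  obtain ⟨i, hi⟩ := hI
  have hm : ∀ n : ℕ, MeasurableSet {y : Fin d → ℝ | 1 / ((n : ℝ) + 1) < y i} := fun n =>
    measurableSet_lt measurable_const (measurable_pi_apply i)
  have h1 : ∀ n : ℕ, ∀ᵐ y, integrateOut Iᶜ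
      ({y : Fin d → ℝ | 1 / ((n : ℝ) + 1) < y i}.indicator (orthantDensity lam)) y ≠ ∞ := by
    intro n
    refine integrateOut_ne_top_ae (hl.measurable.indicator (hm n)) ?_
    rw [lintegral_indicator (hm n)]
    exact hl.tail i _ (by positivity)
  filter_upwards [ae_all_iff.2 h1] with y hy hyO
  obtain ⟨n, hn⟩ := exists_nat_one_div_lt (hyO i)
  convert hy n using 1
  rw [integrateOut_apply, integrateOut_apply]
  refine lintegral_congr fun x => ?_
  rw [indicator_of_mem]
  simpa [Function.updateFinset, hi] using hn

theorem le_of_bounded (hl : IsExponentDensity lam)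
    {K : ℝ} (hK : ∀ y ∈ openOrthant d, ∀ k, 1 < y k → lam y ≤ K)
    [Nonempty (Fin d)] {y : Fin d → ℝ} (hy : y ∈ openOrthant d) :
    lam y ≤ K * 2 ^ (d + 1) * (‖y‖ ^ (d + 1))⁻¹ := by
  have hn : 0 < ‖y‖ := by
    rw [norm_pos_iff]
    exact (openOrthant_subset_cone hy).2
  obtain ⟨k, hk⟩ : ∃ k, ‖y‖ / 2 < y k := by
    by_contra! h
    have : ‖y‖ ≤ ‖y‖ / 2 := (pi_norm_le_iff_of_nonneg (by positivity)).2 fun i => by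
      rw [Real.norm_of_nonneg (hy i).le]
      exact h i
    linarith
  -- The factor `2` makes the rescaled coordinate `k` strictly larger than one, where the bound `K`
  -- applies.
  have ht : 0 < 2 / ‖y‖ := by positivity
  have h1 := hK _ (smul_mem_openOrthant ht hy) k (by
    rw [Pi.smul_apply, smul_eq_mul, div_mul_eq_mul_div, lt_div_iff₀ hn]
    linarith)
  rw [hl.homogeneous _ ht y hy, inv_mul_le_iff₀ (by positivity), div_pow] at h1
  calc lam y ≤ _ := h1
    _ = _ := by ring

/-- Dominated convergence near `y₀`: homogeneity turns the bound `K` into decay of order `(1 + ‖x‖)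
^ (-(d + 1))`, which is integrable in dimension at most `d`. -/
theorem integrateOut_of_bounded (hl : IsExponentDensity lam)
    {K : ℝ} (hK : ∀ y ∈ openOrthant d, ∀ k, 1 < y k → lam y ≤ K)
    {I : Finset (Fin d)} (hI : I.Nonempty) {y₀ : Fin d → ℝ} (hy₀ : y₀ ∈ openOrthant d) :
    integrateOut Iᶜ (orthantDensity lam) y₀ ≠ ∞ ∧
      ContinuousAt (integrateOut Iᶜ (orthantDensity lam)) y₀ := by
  obtain ⟨i, hi⟩ := hI
  have : Nonempty (Fin d) := ⟨i⟩
  set c := y₀ i / 2 with hc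
  have hc0 : 0 < c := half_pos (hy₀ i)
  -- Since `‖w‖ ≥ c` and `‖w‖ ≥ ‖x‖`, one has `(1 + c) ‖w‖ ≥ c (1 + ‖x‖)`, that is, `‖w‖ ≥ κ (1 +
  -- ‖x‖)`.
  set κ := c / (1 + c) with hκ
  have hκ0 : 0 < κ := by positivity
  have hK0 : 0 ≤ K := by
    refine (hl.pos (fun _ => 2) fun _ => two_pos).le.trans (hK _ (fun _ => two_pos) i ?_)
    norm_num
  set bound : ((Iᶜ : Finset (Fin d)) → ℝ) → ℝ := fun x =>
    K * 2 ^ (d + 1) * (κ ^ (d + 1))⁻¹ * (1 + ‖x‖) ^ (-((d : ℝ) + 1)) with hbound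
  have hint : Integrable bound := by
    refine (integrable_one_add_norm ?_).const_mul _
    rw [Module.finrank_pi, Fintype.card_coe]
    have : (Iᶜ : Finset (Fin d)).card ≤ d := by simpa using (Iᶜ : Finset (Fin d)).card_le_univ
    exact_mod_cast Nat.lt_succ_of_le this
  have hfin : ∫⁻ x, ENNReal.ofReal (bound x) ≠ ∞ := hint.lintegral_lt_top.ne
  have hle : ∀ y : Fin d → ℝ, c < y i → ∀ x : (Iᶜ : Finset (Fin d)) → ℝ,
      orthantDensity lam (Function.updateFinset y Iᶜ x) ≤ ENNReal.ofReal (bound x) := by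
    intro y hy x
    set w := Function.updateFinset y Iᶜ x with hw
    by_cases hwO : w ∈ openOrthant d
    · rw [orthantDensity_of_mem hwO]
      refine ENNReal.ofReal_le_ofReal ((hl.le_of_bounded hK hwO).trans ?_)
      have h1 : c ≤ ‖w‖ := by
        have : w i = y i := by simp [hw, Function.updateFinset, hi]
        calc c ≤ w i := by rw [this]; exact hy.le
          _ ≤ ‖w i‖ := Real.le_norm_self _
          _ ≤ ‖w‖ := norm_le_pi_norm _ _
      have h2 : ‖x‖ ≤ ‖w‖ := by
        refine (pi_norm_le_iff_of_nonneg (norm_nonneg _)).2 fun j => ?_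
        have : w j = x j := by simp only [hw, Function.updateFinset, j.2, dite_true]
        rw [← this]
        exact norm_le_pi_norm _ _
      have h3 : κ * (1 + ‖x‖) ≤ ‖w‖ := by
        rw [hκ, div_mul_eq_mul_div, div_le_iff₀ (by positivity)]
        nlinarith
      have h4 : (1 + ‖x‖) ^ (-((d : ℝ) + 1)) = ((1 + ‖x‖) ^ (d + 1))⁻¹ := by
        rw [Real.rpow_neg (by positivity), ← Real.rpow_natCast]
        push_cast
        rfl
      rw [hbound]
      simp only
      rw [h4, mul_assoc _ (κ ^ (d + 1))⁻¹, ← mul_inv, ← mul_pow]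
      gcongr
    · rw [orthantDensity_of_notMem hwO]
      positivity
  have hci : c < y₀ i := half_lt_self (hy₀ i)
  constructor
  · exact ne_top_of_le_ne_top hfin (lintegral_mono (hle y₀ hci))
  · refine tendsto_lintegral_filter_of_dominated_convergence
      (fun x => ENNReal.ofReal (bound x)) ?_ ?_ hfin ?_
    · exact .of_forall fun y => hl.measurable.comp_updateFinset y
    · have : ∀ᶠ y : Fin d → ℝ in nhds y₀, c < y i :=
        (continuous_apply i).continuousAt.eventually (lt_mem_nhds hci)
      filter_upwards [this] with y hy
      exact .of_forall (hle y hy)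
    · refine .of_forall fun x => ?_
      have hcont : Continuous fun y : Fin d → ℝ => Function.updateFinset y Iᶜ x := by
        refine continuous_pi fun j => ?_
        by_cases hj : j ∈ Iᶜ
        · simp only [Function.updateFinset, hj, dite_true]
          exact continuous_const
        · simp only [Function.updateFinset, hj, dite_false]
          exact continuous_apply j
      by_cases hx : ∀ j, 0 < x j
      · have hmem : Function.updateFinset y₀ Iᶜ x ∈ openOrthant d := by
          intro j
          by_cases hj : j ∈ Iᶜ
          · simp only [Function.updateFinset, hj, dite_true]
            exact hx _
          · simp only [Function.updateFinset, hj, dite_false]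
            exact hy₀ j
        have hnhds := isOpen_openOrthant.mem_nhds hmem
        have h1 : ContinuousAt (orthantDensity lam) (Function.updateFinset y₀ Iᶜ x) := by
          have h2 : ContinuousAt (fun y => ENNReal.ofReal (lam y))
              (Function.updateFinset y₀ Iᶜ x) :=
            ENNReal.continuous_ofReal.continuousAt.comp (hl.continuousOn.continuousAt hnhds)
          refine h2.congr ?_
          filter_upwards [hnhds] with z hz
          exact (orthantDensity_of_mem hz).symm
        exact ContinuousAt.comp (f := fun y : Fin d → ℝ => Function.updateFinset y Iᶜ x) h1
          hcont.continuousAt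
      -- For such `x` the integrand is zero for every `y`, so continuity of `lam` at the boundary is
      -- not needed.
      · push Not at hx
        obtain ⟨j, hj⟩ := hx
        have : ∀ y, orthantDensity lam (Function.updateFinset y Iᶜ x) = 0 := fun y => by
          refine orthantDensity_of_notMem fun h => ?_
          have h1 := h j.1
          simp only [Function.updateFinset, j.2, dite_true] at h1
          exact absurd h1 (not_lt.2 hj)
        simp_rw [this]
        exact tendsto_const_nhds

end IsExponentDensity

end ExpMarginal

/-! ### Interaction-free densities -/

section Interaction

variable {d : ℕ} {lam : (Fin d → ℝ) → ℝ}

/-- `lam` has no multiplicative interaction on the open orthant between the coordinates in `A`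
and those in `C`. -/
def NoInteraction (lam : (Fin d → ℝ) → ℝ) (A C : Finset (Fin d)) : Prop :=
  ∀ y ∈ openOrthant d, ∀ z ∈ openOrthant d,
    lam y * lam ((A ∪ C).piecewise z y) = lam (A.piecewise z y) * lam (C.piecewise z y)

theorem piecewise_mem_pi {T : Fin d → Set ℝ} (s : Finset (Fin d)) {y z : Fin d → ℝ}
    (hy : ∀ i, y i ∈ T i) (hz : ∀ i, z i ∈ T i) (i : Fin d) : s.piecewise z y i ∈ T i := by
  by_cases hi : i ∈ s <;> simp [hi, hy, hz]

theorem piecewise_mem_openOrthant (s : Finset (Fin d)) {y z : Fin d → ℝ}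
    (hy : y ∈ openOrthant d) (hz : z ∈ openOrthant d) : s.piecewise z y ∈ openOrthant d :=
  piecewise_mem_pi (T := fun _ => Ioi 0) s hy hz

theorem NoInteraction.symm {A C : Finset (Fin d)} (h : NoInteraction lam A C) :
    NoInteraction lam C A := by
  intro y hy z hz
  rw [Finset.union_comm, h y hy z hz, mul_comm]

/-- Change the `C` coordinates first and then coordinate `j`, starting from the changed point.
Multiplying the two identities leaves a common factor, which positivity allows to cancel. -/
theorem NoInteraction.insert (hpos : ∀ y ∈ openOrthant d, 0 < lam y) {A C : Finset (Fin d)}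
    {j : Fin d} (h : NoInteraction lam A C) (hj : NoInteraction lam A {j}) :
    NoInteraction lam A (insert j C) := by
  intro y hy z hz
  set w := C.piecewise z y with hw
  have hwO : w ∈ openOrthant d := piecewise_mem_openOrthant C hy hz
  have h1 := h y hy z hz
  have h2 := hj w hwO z hz
  have e1 : A.piecewise z w = (A ∪ C).piecewise z y := by
    ext i
    by_cases hA : i ∈ A <;> by_cases hC : i ∈ C <;> simp [hw, Finset.piecewise, hA, hC]
  have e2 : Finset.piecewise {j} z w = (Insert.insert j C).piecewise z y := by
    ext i
    by_cases hA : i = j <;> by_cases hC : i ∈ C <;> simp [hw, Finset.piecewise, hA, hC]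
  have e3 : (A ∪ {j}).piecewise z w = (A ∪ Insert.insert j C).piecewise z y := by
    ext i
    by_cases hA : i ∈ A <;> by_cases hj : i = j <;> by_cases hC : i ∈ C <;>
      simp [hw, Finset.piecewise, hA, hj, hC]
  rw [e1, e2, e3] at h2
  have hb := hpos _ (piecewise_mem_openOrthant (A ∪ C) hy hz)
  have hw0 := hpos w hwO
  refine mul_right_cancel₀ (mul_pos hb hw0).ne' ?_
  calc _ = (lam y * lam ((A ∪ C).piecewise z y)) *
        (lam w * lam ((A ∪ Insert.insert j C).piecewise z y)) := by ring
    _ = _ := by rw [h1, h2]; ring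

theorem noInteraction_of_singletons (hpos : ∀ y ∈ openOrthant d, 0 < lam y)
    {A C : Finset (Fin d)} (h : ∀ i ∈ A, ∀ j ∈ C, NoInteraction lam {i} {j}) :
    NoInteraction lam A C := by
  have h0 : ∀ s : Finset (Fin d), NoInteraction lam s ∅ := fun s y _ z _ => by
    have : (s ∪ ∅).piecewise z y = s.piecewise z y := by
      ext i
      by_cases hi : i ∈ s <;> simp [Finset.piecewise, hi]
    rw [this, Finset.piecewise_empty, mul_comm]
  have h1 : ∀ i ∈ A, NoInteraction lam {i} C := by
    intro i hi
    have h' := h i hi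
    clear h
    induction C using Finset.induction with
    | empty => exact h0 _
    | insert j C _ ih =>
      exact (ih fun l hl => h' l (Finset.mem_insert_of_mem hl)).insert hpos
        (h' j (Finset.mem_insert_self j C))
  clear h
  induction A using Finset.induction with
  | empty => exact (h0 C).symm
  | insert i A _ ih =>
    exact ((ih fun l hl => h1 l (Finset.mem_insert_of_mem hl)).symm.insert hpos
      (h1 i (Finset.mem_insert_self i A)).symm).symm

/-- The absence of interaction is inherited by restrictions to product sets. -/
theorem NoInteraction.fourPoint {A C : Finset (Fin d)} (h : NoInteraction lam A C)
    (hpos : ∀ y ∈ openOrthant d, 0 < lam y) (hAC : Disjoint A C) {T : Fin d → Set ℝ}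
    (hT : ∀ i, T i ⊆ Ioi 0) (c : ℝ≥0∞) :
    FourPoint ((univ.pi T).indicator fun y => c * ENNReal.ofReal (lam y)) A C := by
  intro y z
  have hTO : ∀ w, w ∈ univ.pi T → w ∈ openOrthant d := fun w hw i => hT i (hw i (mem_univ i))
  -- In a product set, `y` and the `A ∪ C` mixture are members exactly when the `A` and `C` mixtures
  -- are, so both sides vanish together. Otherwise `z` is replaced by `w`, because `z` itself may
  -- lie outside.
  by_cases hcase : y ∈ univ.pi T ∧ (A ∪ C).piecewise z y ∈ univ.pi T
  · obtain ⟨hy, hw⟩ := hcase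
    set w := (A ∪ C).piecewise z y with hwdef
    have eA : A.piecewise z y = A.piecewise w y := by
      ext i
      by_cases hA : i ∈ A <;> simp [hwdef, hA]
    have eC : C.piecewise z y = C.piecewise w y := by
      ext i
      by_cases hA : i ∈ C <;> simp [hwdef, hA]
    have eAC : (A ∪ C).piecewise w y = w := by
      ext i
      by_cases hA : i ∈ A ∪ C
      · simp only [Finset.piecewise_eq_of_mem _ _ _ hA]
      · simp only [hwdef, Finset.piecewise_eq_of_notMem _ _ _ hA]
    have mA : A.piecewise w y ∈ univ.pi T := fun i _ =>
      piecewise_mem_pi A (fun i => hy i (mem_univ i)) (fun i => hw i (mem_univ i)) i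
    have mC : C.piecewise w y ∈ univ.pi T := fun i _ =>
      piecewise_mem_pi C (fun i => hy i (mem_univ i)) (fun i => hw i (mem_univ i)) i
    rw [eA, eC, indicator_of_mem hy, indicator_of_mem hw, indicator_of_mem mA, indicator_of_mem mC]
    have h1 := h y (hTO y hy) w (hTO w hw)
    rw [eAC] at h1
    have h2 := congrArg ENNReal.ofReal h1
    rw [ENNReal.ofReal_mul (hpos _ (hTO _ hy)).le, ENNReal.ofReal_mul (hpos _ (hTO _ mA)).le] at h2
    rw [mul_mul_mul_comm, h2, mul_mul_mul_comm]
  · have hcase' : ¬ (A.piecewise z y ∈ univ.pi T ∧ C.piecewise z y ∈ univ.pi T) := by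
      rintro ⟨hA, hC⟩
      refine hcase ⟨fun i _ => ?_, fun i _ => ?_⟩
      · by_cases hi : i ∈ A
        · have := hC i (mem_univ i)
          rwa [Finset.piecewise_eq_of_notMem _ _ _ (Finset.disjoint_left.1 hAC hi)] at this
        · have := hA i (mem_univ i)
          rwa [Finset.piecewise_eq_of_notMem _ _ _ hi] at this
      · by_cases hi : i ∈ A
        · have := hA i (mem_univ i)
          rw [Finset.piecewise_eq_of_mem _ _ _ hi] at this
          rwa [Finset.piecewise_eq_of_mem _ _ _ (Finset.mem_union_left _ hi)]
        · have := hC i (mem_univ i)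
          by_cases hi' : i ∈ C
          · rw [Finset.piecewise_eq_of_mem _ _ _ hi'] at this
            rwa [Finset.piecewise_eq_of_mem _ _ _ (Finset.mem_union_right _ hi')]
          · rw [Finset.piecewise_eq_of_notMem _ _ _ hi'] at this
            rwa [Finset.piecewise_eq_of_notMem]
            simp [hi, hi']
    have hl : ((univ.pi T).indicator fun y => c * ENNReal.ofReal (lam y)) y *
        ((univ.pi T).indicator fun y => c * ENNReal.ofReal (lam y)) ((A ∪ C).piecewise z y) =
        0 := by
      rcases not_and_or.1 hcase with h | h <;> rw [indicator_of_notMem h] <;> simp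
    have hr : ((univ.pi T).indicator fun y => c * ENNReal.ofReal (lam y)) (A.piecewise z y) *
        ((univ.pi T).indicator fun y => c * ENNReal.ofReal (lam y)) (C.piecewise z y) = 0 := by
      rcases not_and_or.1 hcase' with h | h <;> rw [indicator_of_notMem h] <;> simp
    rw [hl, hr]

theorem NoInteraction.fourPoint_orthantDensity {A C : Finset (Fin d)} (h : NoInteraction lam A C)
    (hpos : ∀ y ∈ openOrthant d, 0 < lam y) (hAC : Disjoint A C) :
    FourPoint (orthantDensity lam) A C := by
  have := h.fourPoint hpos hAC (T := fun _ => Ioi 0) (fun _ => subset_rfl) 1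
  simpa only [one_mul, ← openOrthant_eq_pi, orthantDensity] using this

theorem continuous_piecewise (s : Finset (Fin d)) :
    Continuous fun p : (Fin d → ℝ) × (Fin d → ℝ) => s.piecewise p.2 p.1 := by
  refine continuous_pi fun i => ?_
  by_cases hi : i ∈ s
  · simp only [hi, Finset.piecewise_eq_of_mem]; fun_prop
  · simp only [hi, not_false_eq_true, Finset.piecewise_eq_of_notMem]; fun_prop

/-- The open set of points of the open orthant whose `k`-th coordinate exceeds one. -/
def exceedance (k : Fin d) : Set (Fin d → ℝ) := {y | y ∈ openOrthant d ∧ 1 < y k}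

theorem exceedance_eq_pi (k : Fin d) :
    exceedance k = univ.pi fun i => if i = k then Ioi (1 : ℝ) else Ioi 0 := by
  ext y
  simp only [exceedance, mem_ofPred_eq, mem_univ_pi]
  constructor
  · rintro ⟨h1, h2⟩ i
    split_ifs with h
    · exact h ▸ h2
    · exact h1 i
  · intro h
    have hk := h k
    rw [if_pos rfl] at hk
    refine ⟨fun i => ?_, hk⟩
    have hi := h i
    split_ifs at hi with hik
    · exact one_pos.trans hi
    · exact hi

theorem isOpen_exceedance (k : Fin d) : IsOpen (exceedance k) :=
  isOpen_openOrthant.inter (isOpen_lt continuous_const (continuous_apply k))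

theorem piecewise_mem_exceedance (s : Finset (Fin d)) {k : Fin d} {y z : Fin d → ℝ}
    (hy : y ∈ exceedance k) (hz : z ∈ exceedance k) : s.piecewise z y ∈ exceedance k := by
  rw [exceedance_eq_pi] at *
  exact fun i _ => piecewise_mem_pi s (fun i => hy i (mem_univ i)) (fun i => hz i (mem_univ i)) i

/-- An interaction-free almost everywhere version of `lam` on an exceedance set suffices. -/
theorem IsExponentDensity.noInteraction_of_ae (hl : IsExponentDensity lam) {A C : Finset (Fin d)}
    (k : Fin d) {c : ℝ≥0∞} (hc0 : c ≠ 0) (hc : c ≠ ∞) {g : (Fin d → ℝ) → ℝ≥0∞}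
    (hg : ∀ y ∈ exceedance k, ∀ z ∈ exceedance k,
      g y * g ((A ∪ C).piecewise z y) = g (A.piecewise z y) * g (C.piecewise z y))
    (hae : ∀ᵐ y, y ∈ exceedance k → c * ENNReal.ofReal (lam y) = g y) :
    NoInteraction lam A C := by
  have hcont : ∀ s : Finset (Fin d), ContinuousOn
      (fun p : (Fin d → ℝ) × (Fin d → ℝ) => lam (s.piecewise p.2 p.1))
      (exceedance k ×ˢ exceedance k) := fun s =>
    hl.continuousOn.comp (continuous_piecewise s).continuousOn
      fun p hp => (piecewise_mem_exceedance s hp.1 hp.2).1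
  have hfst : ContinuousOn (fun p : (Fin d → ℝ) × (Fin d → ℝ) => lam p.1)
      (exceedance k ×ˢ exceedance k) :=
    hl.continuousOn.comp continuous_fst.continuousOn fun p hp => hp.1.1
  have hO : IsOpen (exceedance k ×ˢ exceedance k) :=
    (isOpen_exceedance k).prod (isOpen_exceedance k)
  have haeq : ∀ᵐ p : (Fin d → ℝ) × (Fin d → ℝ), p ∈ exceedance k ×ˢ exceedance k →
      lam p.1 * lam ((A ∪ C).piecewise p.2 p.1) =
        lam (A.piecewise p.2 p.1) * lam (C.piecewise p.2 p.1) := by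
    have h0 : ∀ᵐ p : (Fin d → ℝ) × (Fin d → ℝ), p.1 ∈ exceedance k →
        c * ENNReal.ofReal (lam p.1) = g p.1 :=
      Measure.quasiMeasurePreserving_fst.ae hae
    filter_upwards [h0, (quasiMeasurePreserving_piecewise (A ∪ C)).ae hae,
      (quasiMeasurePreserving_piecewise A).ae hae,
      (quasiMeasurePreserving_piecewise C).ae hae] with p h1 h2 h3 h4 hp
    have mem := fun s : Finset (Fin d) => piecewise_mem_exceedance s hp.1 hp.2
    have h5 := hg p.1 hp.1 p.2 hp.2
    rw [← h1 hp.1, ← h2 (mem _), ← h3 (mem _), ← h4 (mem _), mul_mul_mul_comm,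
      mul_mul_mul_comm c (ENNReal.ofReal (lam (A.piecewise p.2 p.1))),
      ENNReal.mul_right_inj (mul_ne_zero hc0 hc0) (ENNReal.mul_ne_top hc hc),
      ← ENNReal.ofReal_mul (hl.pos _ hp.1.1).le, ← ENNReal.ofReal_mul (hl.pos _ (mem _).1).le,
      ENNReal.ofReal_eq_ofReal_iff (mul_pos (hl.pos _ hp.1.1) (hl.pos _ (mem _).1)).le
        (mul_pos (hl.pos _ (mem _).1) (hl.pos _ (mem _).1)).le] at h5
    exact h5
  have heq := Measure.eqOn_open_of_ae_eq
    (μ := (volume : Measure ((Fin d → ℝ) × (Fin d → ℝ))))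
    ((ae_restrict_iff' hO.measurableSet).2 haeq) hO (hfst.mul (hcont _))
    ((hcont A).mul (hcont C))
  intro y hy z hz
  -- This scale pushes both `y` and `z` into the exceedance set at once; the four homogeneity
  -- factors then cancel.
  set t : ℝ := (y k)⁻¹ + (z k)⁻¹ with ht
  have hyk := inv_pos.2 (hy k)
  have hzk := inv_pos.2 (hz k)
  have ht0 : 0 < t := add_pos hyk hzk
  have hty : t • y ∈ exceedance k := by
    refine ⟨smul_mem_openOrthant ht0 hy, ?_⟩
    rw [Pi.smul_apply, smul_eq_mul, ← inv_lt_iff_one_lt_mul₀ (hy k)]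
    linarith
  have htz : t • z ∈ exceedance k := by
    refine ⟨smul_mem_openOrthant ht0 hz, ?_⟩
    rw [Pi.smul_apply, smul_eq_mul, ← inv_lt_iff_one_lt_mul₀ (hz k)]
    linarith
  have h1 : lam (t • y) * lam ((A ∪ C).piecewise (t • z) (t • y)) =
      lam (A.piecewise (t • z) (t • y)) * lam (C.piecewise (t • z) (t • y)) :=
    heq (show (t • y, t • z) ∈ exceedance k ×ˢ exceedance k from ⟨hty, htz⟩)
  have h2 : ∀ s : Finset (Fin d), s.piecewise (t • z) (t • y) = t • s.piecewise z y := by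
    intro s
    ext i
    by_cases hi : i ∈ s <;> simp [hi]
  simp only [h2] at h1
  rw [hl.homogeneous t ht0 _ hy, hl.homogeneous t ht0 _ (piecewise_mem_openOrthant _ hy hz),
    hl.homogeneous t ht0 _ (piecewise_mem_openOrthant _ hy hz),
    hl.homogeneous t ht0 _ (piecewise_mem_openOrthant _ hy hz), mul_mul_mul_comm,
    mul_mul_mul_comm (t ^ (d + 1))⁻¹ (lam (A.piecewise z y))] at h1
  exact mul_left_cancel₀ (by positivity) h1

theorem integrateOut_piecewise_of_disjoint {I s : Finset (Fin d)} (h : (Fin d → ℝ) → ℝ≥0∞)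
    (hs : ∀ i ∈ s, i ∉ I) (t : Finset (Fin d)) (y z : Fin d → ℝ) :
    integrateOut Iᶜ h ((s ∪ t).piecewise z y) = integrateOut Iᶜ h (t.piecewise z y) := by
  refine integrateOut_congr h fun i hi => ?_
  have : i ∉ s := fun h' => hi (Finset.mem_compl.2 (hs i h'))
  by_cases hit : i ∈ t <;> simp [Finset.piecewise, this, hit]

/-- A marginal that involves at most one of `i` and `j` has no interaction between them. -/
theorem integrateOut_fourPoint_of_notMem {I : Finset (Fin d)} (h : (Fin d → ℝ) → ℝ≥0∞)
    {i j : Fin d} (hI : i ∉ I ∨ j ∉ I) : FourPoint (integrateOut Iᶜ h) {i} {j} := by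
  intro y z
  have h0 : ∀ s : Finset (Fin d), (∀ l ∈ s, l ∉ I) →
      integrateOut Iᶜ h (s.piecewise z y) = integrateOut Iᶜ h y := fun s hs =>
    integrateOut_congr h fun l hl => Finset.piecewise_eq_of_notMem _ _ _ fun h' =>
      hl (Finset.mem_compl.2 (hs l h'))
  rcases hI with hI | hI
  · have hs : ∀ l ∈ ({i} : Finset (Fin d)), l ∉ I := by simpa using hI
    rw [integrateOut_piecewise_of_disjoint h hs, h0 _ hs]
  · have hs : ∀ l ∈ ({j} : Finset (Fin d)), l ∉ I := by simpa using hI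
    rw [h0 _ hs, mul_comm, Finset.union_comm, integrateOut_piecewise_of_disjoint h hs]

/-- Marginal factorization of an exponent measure density along a separation. -/
theorem IsExponentDensity.mul_eq_of_isSeparation (hl : IsExponentDensity lam)
    {G : SimpleGraph (Fin d)}
    (hQ : ∀ i j, i ≠ j → ¬ G.Adj i j → NoInteraction lam {i} {j}) {A A' B C C' : Finset (Fin d)}
    (hA : A ⊆ A') (hC : C ⊆ C') (hsep : IsSeparation G A' B C') (y : Fin d → ℝ) :
    integrateOut (A ∪ B ∪ C)ᶜ (orthantDensity lam) y * integrateOut Bᶜ (orthantDensity lam) y =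
      integrateOut (A ∪ B)ᶜ (orthantDensity lam) y *
        integrateOut (B ∪ C)ᶜ (orthantDensity lam) y := by
  refine FourPoint.integrateOut_mul_integrateOut hl.measurable hA hC hsep.disjoint_outer
    hsep.disjoint_left hsep.disjoint_right hsep.cover ?_ y
  refine NoInteraction.fourPoint_orthantDensity ?_ hl.pos hsep.disjoint_outer
  refine noInteraction_of_singletons hl.pos fun i hi j hj => hQ i j ?_ (hsep.not_adj i hi j hj)
  rintro rfl
  exact Finset.disjoint_left.1 hsep.disjoint_outer hi hj

/-- Telescoping with `φ I` the `I`-marginal at the fixed point `y`; each step is the marginal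
identity across the separator between the earlier cliques and `C i`. -/
theorem IsExponentDensity.mul_prod_separator (hl : IsExponentDensity lam)
    {G : SimpleGraph (Fin d)}
    (hQ : ∀ i j, i ≠ j → ¬ G.Adj i j → NoInteraction lam {i} {j}) {m : ℕ}
    {C : Fin m → Finset (Fin d)} (hC : IsCliqueSequence G C) (y : Fin d → ℝ) :
    orthantDensity lam y *
        ∏ i with 0 < i.val, integrateOut (separator C i)ᶜ (orthantDensity lam) y =
      ∏ i, integrateOut (C i)ᶜ (orthantDensity lam) y := by
  have := hC.mul_prod_separator (fun I => integrateOut Iᶜ (orthantDensity lam) y) fun i _ => by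
    obtain ⟨A', C', hA, hC', hsep⟩ := hC.exists_isSeparation i
    have hDU : separator C i ⊆ initialUnion C i.val := fun v hv => (mem_separator.1 hv).2
    have hDC : separator C i ⊆ C i := fun v hv => (mem_separator.1 hv).1
    have h1 := hl.mul_eq_of_isSeparation hQ hA hC' hsep y
    rw [Finset.sdiff_union_of_subset hDU, Finset.union_sdiff_of_subset hDC] at h1
    rw [← h1, initialUnion_succ]
    congr 3
    ext v
    have := @hDU v
    simp only [Finset.mem_union, Finset.mem_sdiff]
    tauto
  simpa only [Finset.compl_univ, integrateOut_empty] using this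

/-- A connected component and its complement are separated by `∅`. The marginal identity then
equates `lam` times the infinite total mass with a product of two marginals that are finite almost
everywhere. -/
theorem IsExponentDensity.connected (hl : IsExponentDensity lam) [Nonempty (Fin d)]
    {G : SimpleGraph (Fin d)}
    (hQ : ∀ i j, i ≠ j → ¬ G.Adj i j → NoInteraction lam {i} {j}) : G.Connected := by
  classical
  rw [SimpleGraph.connected_iff]
  refine ⟨fun i j => ?_, inferInstance⟩
  by_contra hij
  set A := Finset.univ.filter fun v => G.Reachable i v with hA
  have hiA : i ∈ A := by simp [hA]
  have hjA : j ∈ Aᶜ := by simpa [hA] using hij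
  have hsep : IsSeparation G A ∅ Aᶜ := by
    refine ⟨Finset.disjoint_empty_right _, disjoint_compl_right, Finset.disjoint_empty_left _, ?_,
      ?_⟩
    · rw [Finset.union_empty, Finset.union_compl]
    · intro a ha c hc hac
      have ha' := (Finset.mem_filter.1 ha).2
      refine (Finset.mem_compl.1 hc) (Finset.mem_filter.2 ⟨Finset.mem_univ _, ?_⟩)
      exact ha'.trans hac.reachable
  have h1 := hl.mul_eq_of_isSeparation hQ subset_rfl subset_rfl hsep
  have hfin : ∀ᵐ y : Fin d → ℝ, y ∉ openOrthant d := by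
    filter_upwards [hl.integrateOut_orthantDensity_ne_top_ae ⟨i, hiA⟩,
      hl.integrateOut_orthantDensity_ne_top_ae ⟨j, hjA⟩] with y hyA hyC hy
    have h2 := h1 y
    rw [Finset.union_empty, Finset.union_compl, Finset.empty_union, Finset.compl_univ,
      Finset.compl_empty, hl.integrateOut_univ_eq_top,
      ENNReal.mul_top (hl.integrateOut_orthantDensity_pos _ hy).ne'] at h2
    exact ENNReal.mul_ne_top (hyA hy) (hyC hy) h2.symm
  have h3 := isOpen_openOrthant.measure_pos volume ⟨1, one_mem_openOrthant (d := d)⟩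
  exact h3.ne' (measure_eq_zero_iff_ae_notMem.2 hfin)

end Interaction

/-! ### Conditional independence of multivariate Pareto vectors -/

section Conditioning

variable {d : ℕ} {lam : (Fin d → ℝ) → ℝ} {P Λ : Measure (Fin d → ℝ)}

/-- The multiple by `c` of `lam`, restricted to an exceedance set. -/
noncomputable def exceedanceDensity (lam : (Fin d → ℝ) → ℝ) (k : Fin d) (c : ℝ≥0∞) :
    (Fin d → ℝ) → ℝ≥0∞ :=
  (exceedance k).indicator fun y => c * ENNReal.ofReal (lam y)

theorem exceedanceDensity_eq_smul (k : Fin d) (c : ℝ≥0∞) :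
    exceedanceDensity lam k c = c • (exceedance k).indicator (orthantDensity lam) := by
  ext y
  by_cases hy : y ∈ exceedance k
  · rw [exceedanceDensity, Pi.smul_apply, indicator_of_mem hy, indicator_of_mem hy,
      orthantDensity_of_mem hy.1, smul_eq_mul]
  · rw [exceedanceDensity, Pi.smul_apply, indicator_of_notMem hy, indicator_of_notMem hy, smul_zero]

theorem IsExponentDensity.measurable_exceedanceDensity (hl : IsExponentDensity lam) (k : Fin d)
    (c : ℝ≥0∞) : Measurable (exceedanceDensity lam k c) := by
  rw [exceedanceDensity_eq_smul]
  exact (hl.measurable.indicator (isOpen_exceedance k).measurableSet).const_smul c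

theorem IsExponentDensity.integrateOut_exceedanceDensity_pos (hl : IsExponentDensity lam)
    (k : Fin d) {c : ℝ≥0∞} (hc : c ≠ 0) (s : Finset (Fin d)) {y : Fin d → ℝ}
    (hy : ∀ i ∉ s, y i ∈ if i = k then Ioi (1 : ℝ) else Ioi 0) :
    0 < integrateOut s (exceedanceDensity lam k c) y := by
  refine integrateOut_pos (hl.measurable_exceedanceDensity k c)
    (fun i => if i = k then Ioi (1 : ℝ) else Ioi 0) (fun i => by split_ifs <;> simp)
    (fun z hz => ?_) hy
  have hzk : z ∈ exceedance k := by
    rw [exceedance_eq_pi]; exact fun i _ => hz i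
  rw [exceedanceDensity, indicator_of_mem hzk]
  exact ENNReal.mul_pos hc (ENNReal.ofReal_pos.2 (hl.pos z hzk.1)).ne'

theorem mem_of_integrateOut_exceedanceDensity_ne_zero {k : Fin d} {c : ℝ≥0∞}
    {s : Finset (Fin d)} {y : Fin d → ℝ} (h : integrateOut s (exceedanceDensity lam k c) y ≠ 0) :
    ∀ i ∉ s, y i ∈ if i = k then Ioi (1 : ℝ) else Ioi 0 := by
  intro i hi
  by_contra hyi
  refine h ?_
  rw [integrateOut_apply]
  refine (lintegral_congr fun x => ?_).trans lintegral_zero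
  refine indicator_of_notMem (fun hx => hyi ?_) _
  rw [exceedance_eq_pi] at hx
  have := hx i (mem_univ i)
  simpa only [Function.updateFinset, hi, dite_false] using this

theorem IsMultivariatePareto.exists_cond_eq (hP : IsMultivariatePareto P Λ)
    (hl : IsExponentDensity lam) (hlam : Λ = volume.withDensity (orthantDensity lam)) (k : Fin d) :
    ∃ c : ℝ≥0∞, c ≠ 0 ∧ c ≠ ∞ ∧ ProbabilityTheory.cond P {y | 1 < y k} =
      volume.withDensity (exceedanceDensity lam k c) := by
  have := hP.isProbabilityMeasure
  have hS : MeasurableSet {y : Fin d → ℝ | 1 < y k} :=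
    measurableSet_lt measurable_const (measurable_pi_apply k)
  have hE := (isOpen_exceedance k).measurableSet
  have hind : Measurable ((exceedance k).indicator (orthantDensity lam)) :=
    hl.measurable.indicator hE
  have hrestr : P.restrict {y | 1 < y k} =
      volume.withDensity (exceedanceDensity lam k (expo Λ 1)⁻¹) := by
    conv_lhs => rw [hP.eq_smul_restrict]
    rw [Measure.restrict_smul, Measure.restrict_restrict hS, exceedanceDensity_eq_smul,
      withDensity_smul _ hind]
    congr 1
    rw [hlam, restrict_withDensity (hS.inter measurableSet_lSpace),
      ← withDensity_indicator (hS.inter measurableSet_lSpace)]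
    congr 1
    ext y
    by_cases hy : y ∈ exceedance k
    · rw [indicator_of_mem hy, indicator_of_mem]
      exact ⟨hy.2, mem_lSpace_of_one_lt hy.1 hy.2⟩
    · rw [indicator_of_notMem hy]
      by_cases hyO : y ∈ openOrthant d
      · exact indicator_of_notMem (fun h => hy ⟨hyO, h.1⟩) _
      · exact (indicator_apply_eq_zero.2 fun _ => orthantDensity_of_notMem hyO).symm ▸ rfl
  have hc0 : (expo Λ 1)⁻¹ ≠ 0 := ENNReal.inv_ne_zero.2 hP.expo_one_ne_top
  have hpos : P {y | 1 < y k} ≠ 0 := by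
    rw [← Measure.restrict_apply_univ, hrestr, withDensity_apply _ MeasurableSet.univ,
      Measure.restrict_univ, ← integrateOut_univ _ 0]
    exact (hl.integrateOut_exceedanceDensity_pos k hc0 Finset.univ
      fun i hi => absurd (Finset.mem_univ i) hi).ne'
  refine ⟨(P {y | 1 < y k})⁻¹ * (expo Λ 1)⁻¹,
    mul_ne_zero (ENNReal.inv_ne_zero.2 (measure_ne_top _ _)) hc0,
    ENNReal.mul_ne_top (ENNReal.inv_ne_top.2 hpos) (ENNReal.inv_ne_top.2 hP.expo_one_ne_zero), ?_⟩
  rw [ProbabilityTheory.cond, hrestr, ← withDensity_smul _ (hl.measurable_exceedanceDensity k _),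
    exceedanceDensity_eq_smul, exceedanceDensity_eq_smul, smul_smul]

theorem margDensity_withDensity_ae_eq {h : (Fin d → ℝ) → ℝ≥0∞} (hh : Measurable h)
    (I : Finset (Fin d)) : margDensity (volume.withDensity h) I =ᵐ[volume] integrateOut Iᶜ h :=
  integrateOut_ae_congr Iᶜ (Measure.rnDeriv_withDensity volume hh)

theorem IsMultivariatePareto.extCondIndep (hP : IsMultivariatePareto P Λ)
    (hl : IsExponentDensity lam) (hlam : Λ = volume.withDensity (orthantDensity lam))
    {G : SimpleGraph (Fin d)}
    (hQ : ∀ i j, i ≠ j → ¬ G.Adj i j → NoInteraction lam {i} {j}) {A A' B C C' : Finset (Fin d)}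
    (hA : A ⊆ A') (hC : C ⊆ C') (hsep : IsSeparation G A' B C') : ExtCondIndep P A B C := by
  intro k
  obtain ⟨c, hc0, hc, hcond⟩ := hP.exists_cond_eq hl hlam k
  have := hP.isProbabilityMeasure
  have hm := hl.measurable_exceedanceDensity k c
  have hno : NoInteraction lam A' C' := by
    refine noInteraction_of_singletons hl.pos fun i hi j hj => hQ i j ?_ (hsep.not_adj i hi j hj)
    rintro rfl
    exact Finset.disjoint_left.1 hsep.disjoint_outer hi hj
  have hfp : FourPoint (exceedanceDensity lam k c) A' C' := by
    rw [exceedanceDensity, exceedance_eq_pi]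
    refine hno.fourPoint hl.pos hsep.disjoint_outer (fun i => ?_) c
    split_ifs
    · exact Ioi_subset_Ioi zero_le_one
    · exact subset_rfl
  have hid := hfp.integrateOut_mul_integrateOut hm hA hC hsep.disjoint_outer
    hsep.disjoint_left hsep.disjoint_right hsep.cover
  have hint : ∫⁻ y, exceedanceDensity lam k c y ≠ ∞ := by
    have h1 : ProbabilityTheory.cond P {y | 1 < y k} univ ≠ ∞ := measure_ne_top _ _
    rwa [hcond, withDensity_apply _ MeasurableSet.univ, Measure.restrict_univ] at h1
  rw [CondIndepGiven, hcond]
  filter_upwards [margDensity_withDensity_ae_eq hm (A ∪ B ∪ C),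
    margDensity_withDensity_ae_eq hm (A ∪ B), margDensity_withDensity_ae_eq hm (B ∪ C),
    margDensity_withDensity_ae_eq hm B, integrateOut_ne_top_ae (s := Bᶜ) hm hint]
    with x h1 h2 h3 h4 h5
  rw [h1, h2, h3, h4]
  -- Here the quotient is `0 / 0 = 0`. The joint marginal vanishes too: otherwise the `B`
  -- coordinates of `x` would lie in the product set, where the `B`-marginal is positive.
  by_cases h0 : integrateOut Bᶜ (exceedanceDensity lam k c) x = 0
  · have h6 := hid x
    rw [h0, mul_zero] at h6
    rw [h0, ← h6, ENNReal.zero_div]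
    by_contra hne
    refine (hl.integrateOut_exceedanceDensity_pos k hc0 Bᶜ fun i hi => ?_).ne' h0
    refine mem_of_integrateOut_exceedanceDensity_ne_zero hne i ?_
    simp only [Finset.mem_compl, Finset.mem_union, not_not] at hi ⊢
    exact .inl (.inr hi)
  · rw [ENNReal.eq_div_iff h0 h5, mul_comm]
    exact hid x

/-- Conditioning on a single coordinate, here `i`, is enough. Each marginal in the quotient omits
`i` or `j`, so the quotient satisfies the four-point identity exactly, and it is an almost
everywhere version of the conditional density. -/
theorem IsMultivariatePareto.noInteraction_of_extCondIndep (hP : IsMultivariatePareto P Λ)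
    (hl : IsExponentDensity lam) (hlam : Λ = volume.withDensity (orthantDensity lam))
    {i j : Fin d} (hij : i ≠ j) (h : ExtCondIndep P {i} {i, j}ᶜ {j}) :
    NoInteraction lam {i} {j} := by
  obtain ⟨c, hc0, hc, hcond⟩ := hP.exists_cond_eq hl hlam i
  have hm := hl.measurable_exceedanceDensity i c
  have hci := h i
  rw [CondIndepGiven, hcond] at hci
  set r := (volume.withDensity (exceedanceDensity lam i c)).rnDeriv volume
  have hu := integrateOut_fourPoint_of_notMem (I := {i} ∪ {i, j}ᶜ) (i := i) (j := j) r
    (.inr (by simp [hij.symm]))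
  have hv := integrateOut_fourPoint_of_notMem (I := {i, j}ᶜ ∪ {j}) (i := i) (j := j) r
    (.inl (by simp [hij]))
  refine hl.noInteraction_of_ae i hc0 hc
    (g := fun x => margDensity (volume.withDensity (exceedanceDensity lam i c)) ({i} ∪ {i, j}ᶜ) x *
      margDensity (volume.withDensity (exceedanceDensity lam i c)) ({i, j}ᶜ ∪ {j}) x /
        margDensity (volume.withDensity (exceedanceDensity lam i c)) {i, j}ᶜ x) ?_ ?_
  · intro y _ z _
    have hw : ∀ s : Finset (Fin d), s ⊆ {i, j} →
        margDensity (volume.withDensity (exceedanceDensity lam i c)) {i, j}ᶜ (s.piecewise z y) =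
          margDensity (volume.withDensity (exceedanceDensity lam i c)) {i, j}ᶜ y := by
      intro s hs
      refine integrateOut_congr r fun l hl => Finset.piecewise_eq_of_notMem _ _ _ fun h' => hl ?_
      rw [compl_compl]
      exact hs h'
    have hu' : margDensity (volume.withDensity (exceedanceDensity lam i c)) ({i} ∪ {i, j}ᶜ) y *
        margDensity (volume.withDensity (exceedanceDensity lam i c)) ({i} ∪ {i, j}ᶜ)
          (({i} ∪ {j} : Finset (Fin d)).piecewise z y) =
        margDensity (volume.withDensity (exceedanceDensity lam i c)) ({i} ∪ {i, j}ᶜ)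
          (({i} : Finset (Fin d)).piecewise z y) *
        margDensity (volume.withDensity (exceedanceDensity lam i c)) ({i} ∪ {i, j}ᶜ)
          (({j} : Finset (Fin d)).piecewise z y) := hu y z
    have hv' : margDensity (volume.withDensity (exceedanceDensity lam i c)) ({i, j}ᶜ ∪ {j}) y *
        margDensity (volume.withDensity (exceedanceDensity lam i c)) ({i, j}ᶜ ∪ {j})
          (({i} ∪ {j} : Finset (Fin d)).piecewise z y) =
        margDensity (volume.withDensity (exceedanceDensity lam i c)) ({i, j}ᶜ ∪ {j})
          (({i} : Finset (Fin d)).piecewise z y) *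
        margDensity (volume.withDensity (exceedanceDensity lam i c)) ({i, j}ᶜ ∪ {j})
          (({j} : Finset (Fin d)).piecewise z y) := hv y z
    rw [hw ({i} ∪ {j}) (by rw [Finset.insert_eq]), hw {i} (by simp), hw {j} (by simp)]
    simp only [div_eq_mul_inv]
    rw [mul_mul_mul_comm, mul_mul_mul_comm (margDensity _ _ y), hu', hv']
    ring
  · have hcov : ({i} ∪ {i, j}ᶜ ∪ {j} : Finset (Fin d))ᶜ = ∅ := by
      ext l
      simp only [Finset.mem_compl, Finset.mem_union, Finset.mem_singleton, Finset.mem_insert,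
        Finset.notMem_empty, iff_false, not_not]
      tauto
    filter_upwards [hci, margDensity_withDensity_ae_eq hm ({i} ∪ {i, j}ᶜ ∪ {j})] with x h1 h2 hx
    rw [← h1, h2, hcov, integrateOut_empty, exceedanceDensity, indicator_of_mem hx]

end Conditioning

/-! ### The factorizations -/

section Factorization

variable {d : ℕ} {lam : (Fin d → ℝ) → ℝ} {G : SimpleGraph (Fin d)} {m : ℕ}
  {C : Fin m → Finset (Fin d)}

theorem FourPoint.prod {ι : Type*} (s : Finset ι) {φ : ι → (Fin d → ℝ) → ℝ≥0∞}
    {A B : Finset (Fin d)} (h : ∀ l ∈ s, FourPoint (φ l) A B) :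
    FourPoint (fun y => ∏ l ∈ s, φ l y) A B := by
  intro y z
  rw [← Finset.prod_mul_distrib, ← Finset.prod_mul_distrib]
  exact Finset.prod_congr rfl fun l hl => h l hl y z

theorem IsCliqueSequence.notMem_or_notMem (hC : IsCliqueSequence G C) {i j : Fin d} (hij : i ≠ j)
    (hadj : ¬ G.Adj i j) (l : Fin m) : i ∉ C l ∨ j ∉ C l := by
  by_contra! h
  exact hadj (((hC.clique_iff _).1 ⟨l, rfl⟩).1 h.1 h.2 hij)

/-- No clique, hence no separator, contains both `i` and `j`, so each factor satisfies the
four-point identity. Positive denominators make inversion multiplicative in `[0,∞]`, even at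
infinite values. -/
theorem IsExponentDensity.noInteraction_of_factorization (hl : IsExponentDensity lam)
    (hC : IsCliqueSequence G C) {f : (Fin d → ℝ) → ℝ} {c : ℝ≥0∞} (hc0 : c ≠ 0) (hc : c ≠ ∞)
    (hf : ∀ y ∈ lSpace d ∩ openOrthant d, ENNReal.ofReal (f y) = c * ENNReal.ofReal (lam y))
    (h : ∀ᵐ y ∂(volume.restrict (lSpace d)), ENNReal.ofReal (f y) =
      c * ((∏ i, expMarginal lam (C i) y) /
        ∏ i with 0 < i.val, expMarginal lam (separator C i) y))
    {i j : Fin d} (hij : i ≠ j) (hadj : ¬ G.Adj i j) : NoInteraction lam {i} {j} := by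
  set N : (Fin d → ℝ) → ℝ≥0∞ := fun y => ∏ l, integrateOut (C l)ᶜ (orthantDensity lam) y with hN
  set D : (Fin d → ℝ) → ℝ≥0∞ := fun y =>
    ∏ l : Fin m with 0 < l.val, integrateOut (separator C l)ᶜ (orthantDensity lam) y with hD
  have hNf : FourPoint N {i} {j} := FourPoint.prod Finset.univ fun l _ =>
    integrateOut_fourPoint_of_notMem _ (hC.notMem_or_notMem hij hadj l)
  have hDf : FourPoint D {i} {j} := by
    refine FourPoint.prod _ fun l _ => integrateOut_fourPoint_of_notMem _ ?_
    exact (hC.notMem_or_notMem hij hadj l).imp (fun h h' => h (mem_separator.1 h').1)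
      fun h h' => h (mem_separator.1 h').1
  have hDpos : ∀ y ∈ openOrthant d, D y ≠ 0 := fun y hy =>
    Finset.prod_ne_zero_iff.2 fun l _ => (hl.integrateOut_orthantDensity_pos _ hy).ne'
  refine hl.noInteraction_of_ae i hc0 hc (g := fun y => c * (N y / D y)) ?_ ?_
  · intro y hy z hz
    have mem := fun s : Finset (Fin d) => (piecewise_mem_exceedance s hy hz).1
    have hinv : (D y)⁻¹ * (D (({i} ∪ {j} : Finset (Fin d)).piecewise z y))⁻¹ =
        (D (({i} : Finset (Fin d)).piecewise z y))⁻¹ *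
          (D (({j} : Finset (Fin d)).piecewise z y))⁻¹ := by
      rw [← ENNReal.mul_inv (.inl (hDpos _ hy.1)) (.inr (hDpos _ (mem _))),
        ← ENNReal.mul_inv (.inl (hDpos _ (mem _))) (.inr (hDpos _ (mem _))), hDf y z]
    simp only [div_eq_mul_inv]
    rw [mul_mul_mul_comm, mul_mul_mul_comm (N y), hNf y z, hinv]
    ring
  · rw [ae_restrict_iff' measurableSet_lSpace] at h
    filter_upwards [h] with y hy hyE
    have hyL := mem_lSpace_of_one_lt hyE.1 hyE.2
    rw [← hf y ⟨hyL, hyE.1⟩, hy hyL]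
    simp only [expMarginal_eq hyE.1, hN, hD]

theorem IsExponentDensity.prod_ne_top_ae (hl : IsExponentDensity lam) {ι : Type*} (s : Finset ι)
    {I : ι → Finset (Fin d)} (hI : ∀ l ∈ s, (I l).Nonempty) :
    ∀ᵐ y : Fin d → ℝ, y ∈ openOrthant d →
      ∏ l ∈ s, integrateOut (I l)ᶜ (orthantDensity lam) y ≠ ∞ := by
  have h : ∀ᵐ y : Fin d → ℝ, ∀ l ∈ s, y ∈ openOrthant d →
      integrateOut (I l)ᶜ (orthantDensity lam) y ≠ ∞ :=
    (Filter.eventually_all_finset s).2 fun l hls =>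
      hl.integrateOut_orthantDensity_ne_top_ae (hI l hls)
  filter_upwards [h] with y hy hyO
  exact ENNReal.prod_ne_top fun l hls => hy l hls hyO

theorem IsExponentDensity.factorization_of_mul_eq (hl : IsExponentDensity lam) [Nonempty (Fin d)]
    (hC : IsCliqueSequence G C) {f : (Fin d → ℝ) → ℝ} {κ : ℝ≥0∞} (hκ0 : κ ≠ 0) (hκ : κ ≠ ∞)
    (hf : ∀ y ∈ lSpace d ∩ openOrthant d, 0 < f y)
    (h : ∀ y ∈ lSpace d ∩ openOrthant d, κ * ENNReal.ofReal (f y) *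
      ∏ i with 0 < i.val, expMarginal lam (separator C i) y = ∏ i, expMarginal lam (C i) y) :
    ∀ᵐ y ∂(volume.restrict (lSpace d)), ENNReal.ofReal (f y) =
      1 / κ * ((∏ i, expMarginal lam (C i) y) /
        ∏ i with 0 < i.val, expMarginal lam (separator C i) y) := by
  have h' : ∀ y ∈ lSpace d ∩ openOrthant d, κ * ENNReal.ofReal (f y) *
      ∏ i with 0 < i.val, integrateOut (separator C i)ᶜ (orthantDensity lam) y =
        ∏ i, integrateOut (C i)ᶜ (orthantDensity lam) y := by
    intro y hy
    simpa only [expMarginal_eq hy.2] using h y hy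
  have hNfin := hl.prod_ne_top_ae Finset.univ (I := C) fun l _ => hC.nonempty l
  -- An empty separator has infinite marginal, which would make the left side of `h'` infinite on an
  -- open set where the right side is finite almost everywhere.
  have hsepne : ∀ l ∈ Finset.univ.filter (fun l : Fin m => 0 < l.val),
      (separator C l).Nonempty := by
    intro l hlpos
    by_contra hne
    rw [Finset.not_nonempty_iff_eq_empty] at hne
    set k := Classical.arbitrary (Fin d)
    have h2 : ∀ᵐ y : Fin d → ℝ, y ∉ exceedance k := by
      filter_upwards [hNfin] with y hy hyk
      have h3 := h' y ⟨mem_lSpace_of_one_lt hyk.1 hyk.2, hyk.1⟩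
      have hfy := hf y ⟨mem_lSpace_of_one_lt hyk.1 hyk.2, hyk.1⟩
      have h4 : ∏ i : Fin m with 0 < i.val,
          integrateOut (separator C i)ᶜ (orthantDensity lam) y = ∞ := by
        rw [← Finset.mul_prod_erase _ _ hlpos, hne, Finset.compl_empty,
          hl.integrateOut_univ_eq_top]
        exact ENNReal.top_mul (Finset.prod_ne_zero_iff.2 fun l _ =>
          (hl.integrateOut_orthantDensity_pos _ hyk.1).ne')
      rw [h4, ENNReal.mul_top (mul_ne_zero hκ0 (ENNReal.ofReal_pos.2 hfy).ne')] at h3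
      exact hy hyk.1 h3.symm
    refine ((isOpen_exceedance k).measure_pos volume ⟨fun _ => 2, fun _ => two_pos, ?_⟩).ne'
      (measure_eq_zero_iff_ae_notMem.2 h2)
    norm_num
  have hDfin := hl.prod_ne_top_ae _ hsepne
  have hO : ∀ᵐ y : Fin d → ℝ, y ∈ cone d → y ∈ openOrthant d := by
    filter_upwards [cone_ae_eq_openOrthant (d := d)] with y hy hyc
    exact (show (y ∈ cone d) = (y ∈ openOrthant d) from hy).mp hyc
  rw [ae_restrict_iff' measurableSet_lSpace]
  filter_upwards [hDfin, hO] with y hD hyO hyL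
  have hy := hyO hyL.1
  have hD0 : ∏ i : Fin m with 0 < i.val,
      integrateOut (separator C i)ᶜ (orthantDensity lam) y ≠ 0 :=
    Finset.prod_ne_zero_iff.2 fun l _ => (hl.integrateOut_orthantDensity_pos _ hy).ne'
  simp only [expMarginal_eq hy]
  rw [← h' y ⟨hyL, hy⟩, ENNReal.mul_div_cancel_right hD0 (hD hy), ← mul_assoc, one_div,
    ENNReal.inv_mul_cancel hκ0 hκ, one_mul]

end Factorization

end ExtremalGraph

/-! ### The main theorem -/

open ExtremalGraph in
theorem theorem1 {d : ℕ} {Ω : Type*} [MeasurableSpace Ω] (ℙ : Measure Ω) [IsProbabilityMeasure ℙ]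
    (Y : Ω → Fin d → ℝ) (hY : AEMeasurable Y ℙ)
    -- `Y` is multivariate Pareto with exponent measure `Λ`
    (Λ : Measure (Fin d → ℝ)) (hPareto : IsMultivariatePareto (ℙ.map Y) Λ)
    -- `f` is a positive and continuous density of `Y` on the L-shaped space
    (f : (Fin d → ℝ) → ℝ)
    (hf : ℙ.map Y = (volume.restrict (lSpace d)).withDensity (fun y => ENNReal.ofReal (f y)))
    (hf_pos : ∀ y ∈ lSpace d ∩ openOrthant d, 0 < f y)
    (hf_cont : ContinuousOn f (lSpace d ∩ openOrthant d))
    -- `lam` is the continuous version of the density of `Λ`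
    (lam : (Fin d → ℝ) → ℝ)
    (hlam : Λ = (volume.restrict (cone d)).withDensity (fun y => ENNReal.ofReal (lam y)))
    (hlam_cont : ContinuousOn lam (openOrthant d))
    -- `G` is decomposable, with cliques `C` and separators `separator C i`, `i > 0`
    (G : SimpleGraph (Fin d)) (hG : IsDecomposable G)
    {m : ℕ} (C : Fin m → Finset (Fin d)) (hC : IsCliqueSequence G C) :
    List.TFAE [
      PairwiseMarkov G (ℙ.map Y),
      GlobalMarkov G (ℙ.map Y),
      -- the factorization, almost everywhere
      ∀ᵐ y ∂(volume.restrict (lSpace d)),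
        ENNReal.ofReal (f y) = 1 / expo Λ 1 *
          ((∏ i, expMarginal lam (C i) y) /
            ∏ i with 0 < i.val, expMarginal lam (separator C i) y),
      -- the factorization, everywhere, without division by a possibly infinite marginal
      ∀ y ∈ lSpace d ∩ openOrthant d,
        expo Λ 1 * ENNReal.ofReal (f y) *
            ∏ i with 0 < i.val, expMarginal lam (separator C i) y
          = ∏ i, expMarginal lam (C i) y] ∧
    (PairwiseMarkov G (ℙ.map Y) → G.Connected) ∧
    -- the marginals are positive and homogeneous, finite almost everywhere, and
    -- finite and continuous if `f` is bounded
    (∀ I : Finset (Fin d), I.Nonempty →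
      (∀ y ∈ openOrthant d, 0 < expMarginal lam I y) ∧
      (∀ t : ℝ, 0 < t → ∀ y ∈ openOrthant d,
        expMarginal lam I (t • y)
          = ENNReal.ofReal (t ^ (-((I.card : ℤ) + 1))) * expMarginal lam I y) ∧
      (∀ᵐ y ∂(volume.restrict (openOrthant d)), expMarginal lam I y ≠ ∞) ∧
      ((∃ M : ℝ, ∀ y ∈ lSpace d ∩ openOrthant d, f y ≤ M) →
        (∀ y ∈ openOrthant d, expMarginal lam I y ≠ ∞) ∧
        ContinuousOn (expMarginal lam I) (openOrthant d))) := by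
  have hne := hPareto.nonempty
  have hlam' : Λ = volume.withDensity (orthantDensity lam) :=
    hlam.trans withDensity_restrict_cone
  have hl := hPareto.isExponentDensity hf hf_pos hf_cont hlam' hlam_cont
  have hκ0 := hPareto.expo_one_ne_zero
  have hκ := hPareto.expo_one_ne_top
  have hflam : ∀ y ∈ lSpace d ∩ openOrthant d,
      ENNReal.ofReal (f y) = (expo Λ 1)⁻¹ * ENNReal.ofReal (lam y) := fun y hy =>
    ofReal_density_eq hPareto hf hf_cont hlam' hlam_cont hy
  have hlamf : ∀ y ∈ lSpace d ∩ openOrthant d,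
      ENNReal.ofReal (lam y) = expo Λ 1 * ENNReal.ofReal (f y) := fun y hy => by
    rw [hflam y hy, ← mul_assoc, ENNReal.mul_inv_cancel hκ0 hκ, one_mul]
  have hpair : PairwiseMarkov G (ℙ.map Y) →
      ∀ i j, i ≠ j → ¬ G.Adj i j → NoInteraction lam {i} {j} := fun h i j hij hadj =>
    hPareto.noInteraction_of_extCondIndep hl hlam' hij (h i j hij hadj)
  have hglobal : (∀ i j, i ≠ j → ¬ G.Adj i j → NoInteraction lam {i} {j}) →
      GlobalMarkov G (ℙ.map Y) := by
    intro hQ A B C _ _ hAB _ hBC hsep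
    obtain ⟨A', C', hA, hC, hs⟩ := hsep.exists_isSeparation hAB hBC
    exact hPareto.extCondIndep hl hlam' hQ hA hC hs
  refine ⟨?_, fun h => hl.connected (hpair h), fun I hI => ⟨?_, ?_, ?_, ?_⟩⟩
  · tfae_have 1 → 2 := fun h => hglobal (hpair h)
    tfae_have 2 → 1 := by
      intro h i j hij hadj
      refine h {i} {i, j}ᶜ {j} (Finset.singleton_nonempty i) (Finset.singleton_nonempty j)
        ?_ ?_ ?_ (separatesIn_pair hij hadj)
      · simp
      · simpa using hij
      · simp
    tfae_have 1 → 4 := by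
      intro h y hy
      rw [← hlamf y hy, ← orthantDensity_of_mem hy.2]
      simp only [expMarginal_eq hy.2]
      exact hl.mul_prod_separator (hpair h) hC y
    tfae_have 4 → 3 := fun h => hl.factorization_of_mul_eq hC hκ0 hκ hf_pos h
    tfae_have 3 → 2 := by
      intro h
      refine hglobal fun i j hij hadj => ?_
      rw [one_div] at h
      exact hl.noInteraction_of_factorization hC (ENNReal.inv_ne_zero.2 hκ)
        (ENNReal.inv_ne_top.2 hκ0) hflam h hij hadj
    tfae_finish
  · intro y hy
    rw [expMarginal_eq hy]
    exact hl.integrateOut_orthantDensity_pos _ hy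
  · intro t ht y hy
    rw [expMarginal_eq hy, expMarginal_eq (smul_mem_openOrthant ht hy)]
    exact hl.integrateOut_orthantDensity_smul I ht y
  · rw [ae_restrict_iff' measurableSet_openOrthant]
    filter_upwards [hl.integrateOut_orthantDensity_ne_top_ae hI] with y hy hyO
    rw [expMarginal_eq hyO]
    exact hy hyO
  · rintro ⟨M, hM⟩
    -- On the exceedance sets `lam` is `Λ(1)` times `f`, so a bound on `f` becomes the bound on
    -- `lam` that homogeneity extends to the orthant.
    have hK : ∀ y ∈ openOrthant d, ∀ k, 1 < y k → lam y ≤ (expo Λ 1).toReal * M := by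
      intro y hy k hk
      have hyL : y ∈ lSpace d ∩ openOrthant d := ⟨mem_lSpace_of_one_lt hy hk, hy⟩
      have h1 := congrArg ENNReal.toReal (hlamf y hyL)
      rw [ENNReal.toReal_mul, ENNReal.toReal_ofReal (hl.pos y hy).le,
        ENNReal.toReal_ofReal (hf_pos y hyL).le] at h1
      rw [h1]
      exact mul_le_mul_of_nonneg_left (hM y hyL) ENNReal.toReal_nonneg
    refine ⟨fun y hy => ?_, fun y hy => ?_⟩
    · rw [expMarginal_eq hy]
      exact (hl.integrateOut_of_bounded hK hI hy).1
    · refine ContinuousWithinAt.congr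
        (hl.integrateOut_of_bounded hK hI hy).2.continuousWithinAt
        (fun z hz => expMarginal_eq hz I) (expMarginal_eq hy I)
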